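/- Let $X$ be a set with at least two elements. Maps are composed from left to right, $(x)ab=((x)a)b$. **Objects.** $Sing(X)$ is the semigroup of singular maps $X\to X$, i.e. those that are neither injective nor surjective (for finite $X$: the non-invertible maps). For $a\in Sing(X)$ let $\operatorname{Im} a$ be its image and $\pi_a$ the partition of $X$ into the fibres of $a$. $\mathscr P(X)$ is the category of non-empty proper subsets of $X$, with all functions as morphisms and the set inclusions as inclusions. $\Pi(X)$ is the category whose objects $\bar\pi$ correspond to the non-identity partitions $\pi$ of $X$ ($\bar\pi$ is the set of all functions $\pi\to X$) and whose morphisms $\bar\pi_1\to\bar\pi_2$ are the maps $\eta^*:\alpha\mapsto\eta\alpha$ with $\eta:\pi_2\to\pi_1$ a function; its inclusions are the $\nu^*:\bar\pi_1\to\bar\pi_2$, where each block of $\pi_2$ is contained in a block of $\pi_1$ and $\nu$ takes it to that block. Both are normal categories in the sense of Nambooripad, and so is each ideal of them (a full subcategory closed under subobjects). **Cones, duals, cross-connections.** For a normal category $\mathcal C$, let $T\mathcal C$ be the set of normal cones $\gamma$ in $\mathcal C$ (with vertex $c_\gamma$), with product $\gamma\cdot\sigma=\gamma*(\sigma(c_\gamma))^\circ$,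 where $f^\circ$ is the epimorphic component of $f$ and $(\gamma * g)(c)=\gamma(c)g$. The H-functor of $\gamma$ is $H(\gamma;c)=\{\gamma*f^\circ: f\in\mathcal C(c_\gamma,c)\}$, $H(\gamma;g):\gamma*f^\circ\mapsto\gamma*(fg)^\circ$; the normal dual $N^*\mathcal C$ has the functors $H(\varepsilon;-)$, $\varepsilon$ an idempotent of $T\mathcal C$, as objects and the natural transformations as morphisms, with subfunctors as subobjects; $MH(\varepsilon;-)=\{c:\varepsilon(c)\text{ is an isomorphism}\}$. A cross-connection $(\mathcal D,\mathcal C;\Gamma)$ is a functor $\Gamma:\mathcal D\to N^*\mathcal C$ that is a local isomorphism (inclusion preserving, fully faithful, and an isomorphism of each principal ideal $\langle d\rangle$ onto $\langle\Gamma(d)\rangle$) such that each $c\in v\mathcal C$ lies in $M\Gamma(d)$ for some $d$. A cross-connection $(\mathcal C,\mathcal D;\Delta)$ is dual to it, with duality $\chi$, if $c\in M\Gamma(d)\iff d\in M\Delta(c)$, and $\chi$ is a natural isomorphism from $\Gamma(-,-)$ to $\Delta(-,-)$, where $\Gamma(c,d)=\Gamma(d)(c)$ and $\Delta(c,d)=\Delta(c)(d)$,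 such that whenever $c\in M\Gamma(d)$, $\chi(c,d)$ takes the idempotent cone $\gamma$ with vertex $c$ and $\Gamma(d)=H(\gamma;-)$ to the idempotent cone $\delta$ with vertex $d$ and $\Delta(c)=H(\delta;-)$. The cross-connection semigroup $\tilde S\Gamma$ consists of the linked pairs, i.e. the pairs $(\gamma,\chi(c,d)(\gamma))$ with $\gamma\in\Gamma(c,d)$ for some $(c,d)$, under $(\gamma,\delta)\circ(\gamma',\delta')=(\gamma\cdot\gamma',\delta'\cdot\delta)$. **Cones of transformations.** For $a\in Sing(X)$, $\rho^a$ is the normal cone in $\mathscr P(X)$ with vertex $\operatorname{Im}a$ and components $a|_A$. $\Pi(X)$ is identified with $N^*\mathscr P(X)$ by $\bar\pi\mapsto H(\rho^e;-)$, $e$ an idempotent with $\pi_e=\pi$, and $\eta^*\mapsto(\rho^e * g^\circ\mapsto\rho^{f} * (wg)^\circ)$ for $\eta:\pi_f\to\pi_e$, where $w:\operatorname{Im}f\to\operatorname{Im}e$ is the map induced by $\eta$. An ideal $\mathcal I$ of $\Pi(X)$ is total if each $A\in v\mathscr P(X)$ belongs to the M-set of the H-functor of some $\bar\pi\in v\mathcal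 I$. For an ideal $\mathcal I$ and $\bar\pi_a\in v\mathcal I$, $\sigma^a$ is the cone in $\mathcal I$ with vertex $\bar\pi_a$ whose component at $\bar\pi$ is $\eta^*$ with $\eta:\pi_a\to\pi$, $[x]\mapsto[xa]$. **Theorem.** Let $\mathcal I$ be a total ideal of $\Pi(X)$ and let $\Gamma=j(\mathcal I,\Pi(X))$ be the inclusion functor, regarded as a functor $\mathcal I\to N^*\mathscr P(X)$ by the above identification. Then: 1. $(\mathcal I,\mathscr P(X);\Gamma)$ is a cross-connection. 2. It has a unique dual cross-connection $\Delta:\mathscr P(X)\to N^*\mathcal I$. This is the identity of $\mathscr P(X)$, when $H(\sigma^e;-)$ is identified with $\operatorname{Im}e$: $\Delta(\operatorname{Im} e)=H(\sigma^e;-)$ for every idempotent $e\in Sing(X)$ with $\bar\pi_e\in v\mathcal I$, and for $f:\operatorname{Im}e\to\operatorname{Im}e'$ ($e,e'$ such idempotents) $\Delta(f)$ is the natural transformation $\sigma^e*g^\circ\mapsto\sigma^{e'}*(\hat f g)^\circ$, where $\hat f:\bar\pi_{e'}\to\bar\pi_e$ is given by the map $\pi_e\to\pi_{e'}$, $[x]\mapsto[(xe)f]$.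 3. $S=\{a\in Sing(X):\bar\pi_a\in v\mathcal I\}$ is a subsemigroup of $Sing(X)$ that is regular and right reductive (if $xa=xb$ for all $x\in S$ then $a=b$), the linked pairs are closed under $\circ$, and $a\mapsto(\rho^a,\sigma^a)$ is an isomorphism of $S$ onto $\tilde S\Gamma$. -/

import Mathlib

open CategoryTheory

universe u

namespace CrossConnection

/-! ## Normal categories

All functions and morphisms are composed from left to right, as `≫` does. -/

/-- A (small) category with subobjects: a category `C` with a partial order `Sub` on its objects
and, for `Sub c d`, a distinguished morphism `incl : c ⟶ d` (the inclusion `j(c, d)`).  The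
inclusions form a subcategory, they are monomorphisms, and if `f ≫ j = j'` with `j, j'`
inclusions then `f` is an inclusion. -/
class SubobjectCategory (C : Type u) extends Category.{u} C where
  Sub : C → C → Prop
  sub_refl : ∀ c, Sub c c
  sub_trans : ∀ {a b c}, Sub a b → Sub b c → Sub a c
  sub_antisymm : ∀ {a b}, Sub a b → Sub b a → a = b
  incl : ∀ {c d : C}, Sub c d → (c ⟶ d)
  incl_refl : ∀ c, incl (sub_refl c) = 𝟙 c
  incl_comp : ∀ {a b c : C} (h : Sub a b) (h' : Sub b c),
    incl h ≫ incl h' = incl (sub_trans h h')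
  incl_mono : ∀ {c d : C} (h : Sub c d), Mono (incl h)
  incl_factor : ∀ {a b c : C} (h : Sub a c) (h' : Sub b c) (f : a ⟶ b),
    f ≫ incl h' = incl h → ∃ k : Sub a b, f = incl k

open SubobjectCategory

attribute [instance] SubobjectCategory.incl_mono

section Normal

variable {C : Type u} [SubobjectCategory C]

/-- A normal factorization `f = e u j`: a retraction, an isomorphism, and an inclusion. -/
structure NormalFactorization {c d : C} (f : c ⟶ d) where
  coimg : C
  img : C
  sub_coimg : Sub coimg c
  sub_img : Sub img d
  e : c ⟶ coimg
  u : coimg ≅ img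
  retraction : incl sub_coimg ≫ e = 𝟙 coimg
  fac : e ≫ u.hom ≫ incl sub_img = f

/-- The epimorphic component `f° = e u` given by a normal factorization of `f`. -/
def NormalFactorization.epi {c d : C} {f : c ⟶ d} (F : NormalFactorization f) : c ⟶ F.img :=
  F.e ≫ F.u.hom

variable (C) in
/-- A cone in `C`, with base the set of all objects of `C`. -/
structure SubCone where
  vertex : C
  app : ∀ c : C, c ⟶ vertex
  compat : ∀ {c c' : C} (h : Sub c c'), incl h ≫ app c' = app c

variable (C) in
/-- A normal cone: a cone of which at least one component is an isomorphism. -/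
structure NormalCone extends SubCone C where
  normal : ∃ c, IsIso (app c)

/-- The M-set of a normal cone. -/
def NormalCone.mSet (γ : NormalCone C) : Set C := {c | IsIso (γ.app c)}

variable (C) in
/-- Normal categories. -/
class IsNormalCategory : Prop where
  factorization : ∀ {c d : C} (f : c ⟶ d), Nonempty (NormalFactorization f)
  splits : ∀ {c d : C} (h : Sub c d), ∃ e : d ⟶ c, incl h ≫ e = 𝟙 c
  exists_cone : ∀ c : C, ∃ γ : NormalCone C, γ.vertex = c ∧ γ.app γ.vertex = 𝟙 _

theorem NormalCone.ext' {γ δ : NormalCone C} (h : γ.vertex = δ.vertex)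
    (happ : ∀ c, γ.app c ≫ eqToHom h = δ.app c) : γ = δ := by
  obtain ⟨⟨v, a, _⟩, _⟩ := γ
  obtain ⟨⟨w, b, _⟩, _⟩ := δ
  dsimp at h
  subst h
  have : a = b := by
    funext c
    simpa using happ c
  subst this
  rfl

section Fac

variable {c d : C} {f : c ⟶ d}

/-- The right inverse of the epimorphic component. -/
def NormalFactorization.sec (F : NormalFactorization f) : F.img ⟶ c :=
  F.u.inv ≫ incl F.sub_coimg

theorem NormalFactorization.sec_epi (F : NormalFactorization f) : F.sec ≫ F.epi = 𝟙 _ := by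
  have := F.retraction
  simp only [sec, epi, Category.assoc]
  rw [reassoc_of% this]
  simp

theorem NormalFactorization.epi_incl (F : NormalFactorization f) :
    F.epi ≫ incl F.sub_img = f := by
  simpa [epi] using F.fac

theorem NormalFactorization.sec_fac (F : NormalFactorization f) :
    F.sec ≫ f = incl F.sub_img := by
  have := F.sec_epi
  calc F.sec ≫ f = F.sec ≫ F.epi ≫ incl F.sub_img := by rw [F.epi_incl]
    _ = _ := by rw [reassoc_of% this]

theorem NormalFactorization.img_sub (F G : NormalFactorization f) : Sub F.img G.img := by
  obtain ⟨k, _⟩ := incl_factor F.sub_img G.sub_img (F.sec ≫ G.epi)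
    (by rw [Category.assoc, G.epi_incl, F.sec_fac])
  exact k

theorem NormalFactorization.img_eq (F G : NormalFactorization f) : F.img = G.img :=
  sub_antisymm (F.img_sub G) (G.img_sub F)

theorem incl_eqToHom {a b b' : C} (h : Sub a b) (e : b = b') :
    incl h ≫ eqToHom e = incl (e ▸ h) := by
  subst e; simp

theorem eqToHom_incl {a a' b : C} (h : Sub a' b) (e : a = a') :
    eqToHom e ≫ incl h = incl (e ▸ h) := by
  subst e; simp

theorem NormalFactorization.epi_eq (F G : NormalFactorization f) :
    F.epi ≫ eqToHom (F.img_eq G) = G.epi := by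
  rw [← cancel_mono (incl G.sub_img), G.epi_incl, Category.assoc, eqToHom_incl, F.epi_incl]

end Fac

/-- The cone `γ * f°`, for a given normal factorization of `f`. -/
def NormalCone.starFac [IsNormalCategory C] (γ : NormalCone C) {d : C} {f : γ.vertex ⟶ d}
    (F : NormalFactorization f) : NormalCone C where
  vertex := F.img
  app c := γ.app c ≫ F.epi
  compat h := by rw [← Category.assoc, γ.compat h]
  normal := by
    obtain ⟨c, hc⟩ := γ.normal
    obtain ⟨G⟩ := IsNormalCategory.factorization (F.sec ≫ inv (γ.app c))
    refine ⟨G.img, ?_⟩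
    have h1 : incl G.sub_img ≫ γ.app c = γ.app G.img := γ.compat _
    have h2 : G.epi ≫ (γ.app G.img ≫ F.epi) = 𝟙 _ := by
      have h3 : G.epi ≫ γ.app G.img = F.sec := by
        rw [← h1, ← Category.assoc, G.epi_incl, Category.assoc, IsIso.inv_hom_id,
          Category.comp_id]
      rw [← Category.assoc, h3, F.sec_epi]
    refine ⟨G.epi, ?_, h2⟩
    have h4 : G.sec ≫ G.epi = 𝟙 _ := G.sec_epi
    calc (γ.app G.img ≫ F.epi) ≫ G.epi
        = (G.sec ≫ G.epi) ≫ (γ.app G.img ≫ F.epi) ≫ G.epi := by rw [h4, Category.id_comp]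
      _ = G.sec ≫ (G.epi ≫ (γ.app G.img ≫ F.epi)) ≫ G.epi := by simp only [Category.assoc]
      _ = 𝟙 _ := by rw [h2, Category.id_comp, h4]

theorem NormalCone.starFac_eq [IsNormalCategory C] (γ : NormalCone C) {d : C}
    {f : γ.vertex ⟶ d} (F G : NormalFactorization f) : γ.starFac F = γ.starFac G :=
  NormalCone.ext' (F.img_eq G) fun c => by
    exact (Category.assoc _ _ _).trans (congrArg (γ.app c ≫ ·) (F.epi_eq G))

/-- The cone `γ * f°`.  It does not depend on the factorization (`NormalCone.starFac_eq`). -/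
noncomputable def NormalCone.star [IsNormalCategory C] (γ : NormalCone C) {d : C}
    (f : γ.vertex ⟶ d) : NormalCone C :=
  γ.starFac (Classical.choice (IsNormalCategory.factorization f))

/-- The multiplication `γ · σ = γ * (σ(c_γ))°` of the semigroup `TC` of normal cones in `C`. -/
noncomputable instance [IsNormalCategory C] : Mul (NormalCone C) :=
  ⟨fun γ σ => γ.star (σ.app γ.vertex)⟩

theorem NormalCone.star_spec [IsNormalCategory C] (γ : NormalCone C) {d : C}
    (f : γ.vertex ⟶ d) : ∃ h : Sub (γ.star f).vertex d,
      ∀ c, (γ.star f).app c ≫ incl h = γ.app c ≫ f := by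
  let F := Classical.choice (IsNormalCategory.factorization f)
  refine ⟨F.sub_img, fun c => ?_⟩
  exact (Category.assoc _ _ _).trans (congrArg (γ.app c ≫ ·) F.epi_incl)

theorem NormalCone.star_injective [IsNormalCategory C] (γ : NormalCone C) {d : C}
    {f g : γ.vertex ⟶ d} (h : γ.star f = γ.star g) : f = g := by
  obtain ⟨c, hc⟩ := γ.normal
  obtain ⟨h1, h2⟩ := γ.star_spec f
  obtain ⟨h3, h4⟩ := γ.star_spec g
  rw [← cancel_epi (γ.app c), ← h2, ← h4]
  clear h2 h4
  revert h1 h3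
  rw [h]
  intro _ _
  rfl

theorem NormalCone.star_id [IsNormalCategory C] (γ : NormalCone C) : γ.star (𝟙 γ.vertex) = γ := by
  let F : NormalFactorization (𝟙 γ.vertex) :=
    { coimg := γ.vertex
      img := γ.vertex
      sub_coimg := sub_refl _
      sub_img := sub_refl _
      e := 𝟙 _
      u := Iso.refl _
      retraction := by rw [incl_refl, Category.id_comp]
      fac := by simp [incl_refl] }
  refine (γ.starFac_eq _ F).trans (NormalCone.ext' rfl fun c => ?_)
  change (γ.app c ≫ 𝟙 _ ≫ 𝟙 _) ≫ 𝟙 _ = _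
  simp

theorem NormalCone.mul_self_of_app [IsNormalCategory C] (γ : NormalCone C)
    (h : γ.app γ.vertex = 𝟙 _) : γ * γ = γ := by
  change γ.star (γ.app γ.vertex) = γ
  rw [h, γ.star_id]

end Normal

/-! ## The normal dual -/

section Dual

variable (C : Type u) [SubobjectCategory C]

/-- A functor from `C` to sets, all of whose values are subsets of the set of normal cones. -/
structure ConeFunctor where
  obj : C → Set (NormalCone C)
  map : ∀ {c d : C}, (c ⟶ d) → obj c → obj d
  map_id : ∀ (c : C) (x : obj c), map (𝟙 c) x = x
  map_comp : ∀ {b c d : C} (f : b ⟶ c) (g : c ⟶ d) (x : obj b), map (f ≫ g) x = map g (map f x)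

variable {C} [IsNormalCategory C]

/-- The set `H(γ; c) = {γ * f° : f ∈ C(c_γ, c)}`. -/
def hSet (γ : NormalCone C) (c : C) : Set (NormalCone C) :=
  {δ | ∃ f : γ.vertex ⟶ c, γ.star f = δ}

/-- The map `H(γ; g) : γ * f° ↦ γ * (f g)°`. -/
noncomputable def hMap (γ : NormalCone C) {c d : C} (g : c ⟶ d) (x : hSet γ c) : hSet γ d :=
  ⟨γ.star (x.2.choose ≫ g), _, rfl⟩

theorem hMap_star (γ : NormalCone C) {c d : C} (g : c ⟶ d) (f : γ.vertex ⟶ c) :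
    hMap γ g ⟨γ.star f, f, rfl⟩ = ⟨γ.star (f ≫ g), _, rfl⟩ := by
  have h : ∃ f' : γ.vertex ⟶ c, γ.star f' = γ.star f := ⟨f, rfl⟩
  have : h.choose = f := γ.star_injective h.choose_spec
  apply Subtype.ext
  change γ.star (h.choose ≫ g) = _
  rw [this]

/-- The map `γ * f° ↦ γ' * (w f)°` from `H(γ; c)` to `H(γ'; c)`. -/
noncomputable def hTrans {γ γ' : NormalCone C} (w : γ'.vertex ⟶ γ.vertex) (c : C)
    (x : hSet γ c) : hSet γ' c :=
  ⟨γ'.star (w ≫ x.2.choose), _, rfl⟩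

theorem hTrans_star {γ γ' : NormalCone C} (w : γ'.vertex ⟶ γ.vertex) {c : C}
    (f : γ.vertex ⟶ c) :
    hTrans w c ⟨γ.star f, f, rfl⟩ = ⟨γ'.star (w ≫ f), _, rfl⟩ := by
  have h : ∃ f' : γ.vertex ⟶ c, γ.star f' = γ.star f := ⟨f, rfl⟩
  have : h.choose = f := γ.star_injective h.choose_spec
  apply Subtype.ext
  change γ'.star (w ≫ h.choose) = _
  rw [this]

/-- The H-functor `H(γ; -)`. -/
noncomputable def hFunctor (γ : NormalCone C) : ConeFunctor C where
  obj := hSet γ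
  map := hMap γ
  map_id := by
    rintro c ⟨_, f, rfl⟩
    rw [hMap_star]
    simp
  map_comp := by
    rintro b c d f g ⟨_, k, rfl⟩
    rw [hMap_star, hMap_star, hMap_star]
    simp

variable (C) in
/-- The normal dual `N*C`: its objects are the H-functors `H(ε; -)` of the idempotents `ε` of the
semigroup `TC`, its morphisms the natural transformations. -/
structure NormalDual extends ConeFunctor C where
  isH : ∃ ε : NormalCone C, IsIdempotentElem ε ∧ toConeFunctor = hFunctor ε

namespace NormalDual

/-- Natural transformations. -/
@[ext]
structure Hom (F G : NormalDual C) where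
  app : ∀ c : C, F.obj c → G.obj c
  naturality : ∀ {c d : C} (g : c ⟶ d) (x : F.obj c), app d (F.map g x) = G.map g (app c x)

instance : Category.{u} (NormalDual C) where
  Hom := Hom
  id F := ⟨fun _ x => x, fun _ _ => rfl⟩
  comp σ τ := ⟨fun c x => τ.app c (σ.app c x), fun g x => by rw [σ.naturality, τ.naturality]⟩

theorem ext_cf {F G : NormalDual C} (h : F.toConeFunctor = G.toConeFunctor) : F = G := by
  cases F; cases G; cases h; rfl

/-- `F` is a subfunctor of `G`. -/
def IsSub (F G : NormalDual C) : Prop :=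
  ∃ h : ∀ c, F.obj c ⊆ G.obj c, ∀ {c d : C} (g : c ⟶ d) (x : F.obj c),
    (F.map g x : NormalCone C) = G.map g ⟨x, h c x.2⟩

/-- The subobjects of an H-functor are those H-functors that are subfunctors of it. -/
instance : SubobjectCategory (NormalDual C) where
  Sub := IsSub
  sub_refl F := ⟨fun _ => subset_rfl, fun _ _ => rfl⟩
  sub_trans := by
    rintro F G H ⟨h, k⟩ ⟨h', k'⟩
    refine ⟨fun c => (h c).trans (h' c), fun {c d} g x => ?_⟩
    rw [k g x, k' g ⟨x, h c x.2⟩]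
  sub_antisymm := by
    rintro ⟨⟨o, m, _, _⟩, _⟩ ⟨⟨o', m', _, _⟩, _⟩ ⟨h, k⟩ ⟨h', _⟩
    apply ext_cf
    have ho : o = o' := funext fun c => Set.Subset.antisymm (h c) (h' c)
    subst ho
    have hm : @m = @m' := by
      funext c d g x
      exact Subtype.ext (k g x)
    subst hm
    rfl
  incl h := ⟨fun c x => ⟨x, h.1 c x.2⟩, fun g x => Subtype.ext (h.2 g x)⟩
  incl_refl _ := rfl
  incl_comp _ _ := rfl
  incl_mono h := ⟨fun σ τ e => by
    apply Hom.ext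
    funext c x
    have := congrArg (fun η : Hom _ _ => (η.app c x : NormalCone C)) e
    exact Subtype.ext this⟩
  incl_factor := by
    rintro F G H h h' σ e
    have key : ∀ c (x : F.obj c), (σ.app c x : NormalCone C) = x := fun c x =>
      congrArg (fun η : Hom _ _ => (η.app c x : NormalCone C)) e
    have hs : ∀ c, F.obj c ⊆ G.obj c := fun c x hx => by
      have := (σ.app c ⟨x, hx⟩).2
      rwa [key] at this
    have hk : ∀ c (x : F.obj c), σ.app c x = ⟨x, hs c x.2⟩ := fun c x => Subtype.ext (key c x)
    refine ⟨⟨hs, fun {c d} g x => ?_⟩, ?_⟩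
    · rw [← key d (F.map g x), σ.naturality, hk]
    · apply Hom.ext
      funext c x
      exact hk c x

/-- The M-set of an H-functor: `M H(ε; -) = M ε`. -/
def mSet (F : NormalDual C) : Set C :=
  {c | ∃ ε : NormalCone C, IsIdempotentElem ε ∧ F.toConeFunctor = hFunctor ε ∧ c ∈ ε.mSet}

/-- The H-functor of an idempotent normal cone, as an object of the normal dual. -/
noncomputable def ofCone (ε : NormalCone C) (h : IsIdempotentElem ε) : NormalDual C :=
  ⟨hFunctor ε, ε, h, rfl⟩

/-- The natural transformation `ε * f° ↦ ε' * (w f)°` from `H(ε; -)` to `H(ε'; -)` determined by a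
morphism `w` from the vertex of `ε'` to the vertex of `ε`. -/
noncomputable def homOf {ε ε' : NormalCone C} (h : IsIdempotentElem ε) (h' : IsIdempotentElem ε')
    (w : ε'.vertex ⟶ ε.vertex) : ofCone ε h ⟶ ofCone ε' h' :=
  Hom.mk (F := ofCone ε h) (G := ofCone ε' h') (fun c => hTrans w c) (by
    rintro c d g ⟨_, f, rfl⟩
    change hTrans w d (hMap ε g ⟨ε.star f, f, rfl⟩) = hMap ε' g (hTrans w c ⟨ε.star f, f, rfl⟩)
    rw [hMap_star, hTrans_star, hTrans_star, hMap_star]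
    simp)

theorem homOf_star {ε ε' : NormalCone C} (h : IsIdempotentElem ε) (h' : IsIdempotentElem ε')
    (w : ε'.vertex ⟶ ε.vertex) {c : C} (f : ε.vertex ⟶ c) :
    Hom.app (homOf h h' w) c ⟨ε.star f, f, rfl⟩ = ⟨ε'.star (w ≫ f), _, rfl⟩ :=
  hTrans_star w f

theorem homOf_id {ε : NormalCone C} (h : IsIdempotentElem ε) : homOf h h (𝟙 _) = 𝟙 _ := by
  apply Hom.ext
  funext c ⟨_, f, hf⟩
  subst hf
  rw [homOf_star]
  simp only [Category.id_comp]
  rfl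

theorem homOf_comp {ε₁ ε₂ ε₃ : NormalCone C} (h₁ : IsIdempotentElem ε₁)
    (h₂ : IsIdempotentElem ε₂) (h₃ : IsIdempotentElem ε₃) (w : ε₂.vertex ⟶ ε₁.vertex)
    (v : ε₃.vertex ⟶ ε₂.vertex) : homOf h₁ h₃ (v ≫ w) = homOf h₁ h₂ w ≫ homOf h₂ h₃ v := by
  apply Hom.ext
  funext c ⟨_, f, hf⟩
  subst hf
  change _ = Hom.app (homOf h₂ h₃ v) c (Hom.app (homOf h₁ h₂ w) c _)
  rw [homOf_star, homOf_star, homOf_star]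
  simp

end NormalDual

end Dual

/-! ## Ideals, local isomorphisms, cross-connections -/

/-- An ideal of a category with subobjects: the full subcategory on a set of objects that contains
every subobject of each of its members. -/
structure CatIdeal (C : Type u) [SubobjectCategory C] where
  carrier : Set C
  down : ∀ {c d : C}, Sub c d → d ∈ carrier → c ∈ carrier

namespace CatIdeal

variable {C : Type u} [SubobjectCategory C] (I : CatIdeal C)

/-- The objects of an ideal. -/
def Obj : Type u := {c : C // c ∈ I.carrier}

instance : Category.{u} I.Obj where
  Hom a b := a.1 ⟶ b.1
  id a := 𝟙 a.1
  comp f g := f ≫ g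

instance : SubobjectCategory I.Obj where
  Sub a b := Sub a.1 b.1
  sub_refl a := sub_refl a.1
  sub_trans h h' := sub_trans h h'
  sub_antisymm h h' := Subtype.ext (sub_antisymm h h')
  incl h := incl (C := C) h
  incl_refl a := incl_refl a.1
  incl_comp h h' := incl_comp (C := C) h h'
  incl_mono h := ⟨fun {c} f g e => (incl_mono (C := C) h).right_cancellation (Z := c.1) f g e⟩
  incl_factor h h' f e := incl_factor (C := C) h h' f e

/-- The inclusion functor `j(I, C)`. -/
def inclusion : I.Obj ⥤ C where
  obj a := a.1
  map f := f

/-- An ideal of a normal category is a normal category. -/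
instance [IsNormalCategory C] : IsNormalCategory I.Obj where
  factorization {c d} f := by
    obtain ⟨F⟩ := IsNormalCategory.factorization (C := C) (c := c.1) (d := d.1) f
    exact ⟨{
      coimg := ⟨F.coimg, I.down F.sub_coimg c.2⟩
      img := ⟨F.img, I.down F.sub_img d.2⟩
      sub_coimg := F.sub_coimg
      sub_img := F.sub_img
      e := F.e
      u := ⟨F.u.hom, F.u.inv, F.u.hom_inv_id, F.u.inv_hom_id⟩
      retraction := F.retraction
      fac := F.fac }⟩
  splits h := IsNormalCategory.splits (C := C) h
  exists_cone c := by
    obtain ⟨c, hc⟩ := c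
    obtain ⟨γ, rfl, hγ⟩ := IsNormalCategory.exists_cone (C := C) c
    refine ⟨⟨⟨⟨γ.vertex, hc⟩, fun d => γ.app d.1, fun h => γ.compat h⟩, ⟨γ.vertex, hc⟩, ?_⟩,
      rfl, hγ⟩
    exact ⟨𝟙 γ.vertex, by
      change γ.app γ.vertex ≫ 𝟙 _ = 𝟙 _
      rw [hγ, Category.comp_id], by
      change 𝟙 _ ≫ γ.app γ.vertex = 𝟙 _
      rw [hγ, Category.comp_id]⟩

end CatIdeal

section Connection

variable {C D : Type u} [SubobjectCategory C] [SubobjectCategory D]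

/-- A local isomorphism: inclusion preserving, fully faithful, and an isomorphism of each
principal ideal `⟨c⟩` onto `⟨F c⟩`.  (A principal ideal is the full subcategory of the subobjects of
its generator, so for a fully faithful functor the last condition says that the functor is a
bijection on objects, from the subobjects of `c` to those of `F c`.) -/
structure IsLocalIso (F : C ⥤ D) : Prop where
  map_incl : ∀ {c d : C} (h : Sub c d), ∃ k : Sub (F.obj c) (F.obj d), F.map (incl h) = incl k
  full : F.Full
  faithful : F.Faithful
  bijOn : ∀ c : C, Set.BijOn F.obj {a | Sub a c} {b | Sub b (F.obj c)}

variable [IsNormalCategory C] [IsNormalCategory D]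

/-- `(D, C; Γ)` is a cross-connection from `D` to `C`. -/
structure IsCrossConnection (Γ : D ⥤ NormalDual C) : Prop where
  localIso : IsLocalIso Γ
  exists_mem : ∀ c : C, ∃ d : D, c ∈ (Γ.obj d).mSet

/-- `Γ(f, g) : Γ(c, d) → Γ(c', d')`, for the bifunctor `Γ(c, d) = Γ(d)(c)` on `C × D`. -/
def leftMap (Γ : D ⥤ NormalDual C) {c c' : C} {d d' : D} (f : c ⟶ c') (g : d ⟶ d')
    (x : (Γ.obj d).obj c) : (Γ.obj d').obj c' :=
  NormalDual.Hom.app (Γ.map g) c' ((Γ.obj d).map f x)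

/-- `Δ(f, g) : Δ(c, d) → Δ(c', d')`, for the bifunctor `Δ(c, d) = Δ(c)(d)` on `C × D`. -/
def rightMap (Δ : C ⥤ NormalDual D) {c c' : C} {d d' : D} (f : c ⟶ c') (g : d ⟶ d')
    (x : (Δ.obj c).obj d) : (Δ.obj c').obj d' :=
  NormalDual.Hom.app (Δ.map f) d' ((Δ.obj c).map g x)

/-- `Δ` is a dual cross-connection of `Γ`, with duality `χ`: both are cross-connections,
`c ∈ M Γ(d)` iff `d ∈ M Δ(c)`, and `χ` is a natural isomorphism from `Γ(-, -)` to `Δ(-, -)` such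
that, whenever `c ∈ M Γ(d)`, it takes the idempotent cone `γ(c, d)` (the idempotent cone `γ` with
vertex `c` and `Γ(d) = H(γ; -)`) to the idempotent cone `δ(c, d)` (the idempotent cone `δ` with
vertex `d` and `Δ(c) = H(δ; -)`). -/
structure Duality (Γ : D ⥤ NormalDual C) (Δ : C ⥤ NormalDual D) where
  isCross : IsCrossConnection Γ
  isCross_dual : IsCrossConnection Δ
  mem_iff : ∀ (c : C) (d : D), c ∈ (Γ.obj d).mSet ↔ d ∈ (Δ.obj c).mSet
  χ : ∀ (c : C) (d : D), (Γ.obj d).obj c ≃ (Δ.obj c).obj d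
  naturality : ∀ {c c' : C} {d d' : D} (f : c ⟶ c') (g : d ⟶ d') (x : (Γ.obj d).obj c),
    χ c' d' (leftMap Γ f g x) = rightMap Δ f g (χ c d x)
  unit : ∀ (c : C) (d : D) (x : (Γ.obj d).obj c) (y : (Δ.obj c).obj d),
    IsIdempotentElem x.1 → x.1.vertex = c → (Γ.obj d).toConeFunctor = hFunctor x.1 →
    IsIdempotentElem y.1 → y.1.vertex = d → (Δ.obj c).toConeFunctor = hFunctor y.1 →
    χ c d x = y

/-- The set of linked pairs `(γ, δ)`, in `TC × (TD)ᵒᵖ`.  With the multiplication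
`(γ, δ) ∘ (γ', δ') = (γ · γ', δ' · δ)` of `TC × (TD)ᵒᵖ` it is the cross-connection semigroup. -/
def linkedPairs {Γ : D ⥤ NormalDual C} {Δ : C ⥤ NormalDual D} (χ : Duality Γ Δ) :
    Set (NormalCone C × (NormalCone D)ᵐᵒᵖ) :=
  {p | ∃ (c : C) (d : D) (h : p.1 ∈ (Γ.obj d).obj c), p.2.unop = (χ.χ c d ⟨p.1, h⟩).1}

end Connection

/-! ## Singular transformations -/

/-- The semigroup `Sing(X)` of singular transformations: the maps from `X` to itself that are
neither injective nor surjective, i.e. whose image is a proper subset and whose kernel is a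
non-identity partition.  For finite `X` these are the non-invertible maps (`sing_iff_of_finite`);
for infinite `X` the non-invertible maps are not closed under composition. -/
@[ext]
structure Sing (X : Type u) where
  toFun : X → X
  not_injective : ¬ Function.Injective toFun
  not_surjective : ¬ Function.Surjective toFun

theorem sing_iff_of_finite {X : Type u} [Finite X] (a : X → X) :
    ¬ Function.Bijective a ↔ ¬ Function.Injective a ∧ ¬ Function.Surjective a := by
  simp [Function.Bijective, Finite.injective_iff_surjective]

/-- Maps are composed from left to right. -/
instance (X : Type u) : Semigroup (Sing X) where
  mul a b := ⟨fun x => b.toFun (a.toFun x),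
    fun h => a.not_injective (Function.Injective.of_comp (f := b.toFun) h),
    fun h => b.not_surjective (Function.Surjective.of_comp (g := a.toFun) h)⟩
  mul_assoc _ _ _ := rfl

/-! ## The powerset category -/

/-- The objects of the powerset category: the non-empty proper subsets of `X`. -/
@[ext]
structure Pow (X : Type u) where
  carrier : Set X
  nonempty : carrier.Nonempty
  ne_univ : carrier ≠ Set.univ

namespace Pow

variable {X : Type u}

instance : Category.{u} (Pow X) where
  Hom A B := A.carrier → B.carrier
  id A := fun x => x
  comp f g := fun x => g (f x)

instance : SubobjectCategory (Pow X) where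
  Sub A B := A.carrier ⊆ B.carrier
  sub_refl _ := subset_rfl
  sub_trans h h' := h.trans h'
  sub_antisymm h h' := Pow.ext (Set.Subset.antisymm h h')
  incl h := fun x => ⟨x, h x.2⟩
  incl_refl _ := rfl
  incl_comp _ _ := rfl
  incl_mono h := ⟨fun f g e => by
    funext x
    have k := congrArg Subtype.val (congrFun e x)
    exact Subtype.ext k⟩
  incl_factor h h' f e := by
    have key : ∀ x, (f x).1 = x.1 := fun x => congrArg Subtype.val (congrFun e x)
    refine ⟨fun x hx => ?_, funext fun x => Subtype.ext (key x)⟩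
    have k := (f ⟨x, hx⟩).2
    rwa [key] at k

/-- The image of a singular transformation. -/
def im (a : Sing X) : Pow X where
  carrier := Set.range a.toFun
  nonempty := by
    by_contra h
    rw [Set.not_nonempty_iff_eq_empty, Set.range_eq_empty_iff] at h
    exact a.not_injective fun x => h.elim x
  ne_univ h := a.not_surjective (Set.range_eq_univ.mp h)

/-- The cone with vertex `Im a` whose component at `A` is the restriction of `a` to `A`. -/
def rhoCone (a : Sing X) : SubCone (Pow X) where
  vertex := im a
  app _ := fun x => ⟨a.toFun x, x, rfl⟩
  compat _ := rfl

/-- The normal cone `ρ^a` determined by the transformation `a`. -/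
def rho (a : Sing X) : NormalCone (Pow X) where
  toSubCone := rhoCone a
  normal := by
    let s : (im a).carrier → X := fun y => y.2.choose
    have hs : ∀ y, a.toFun (s y) = y := fun y => y.2.choose_spec
    let B : Pow X :=
      { carrier := Set.range s
        nonempty := by
          obtain ⟨y, hy⟩ := (im a).nonempty
          exact ⟨s ⟨y, hy⟩, _, rfl⟩
        ne_univ := fun h => a.not_injective fun x y hxy => by
          obtain ⟨x', rfl⟩ := (h ▸ Set.mem_univ x : x ∈ Set.range s)
          obtain ⟨y', rfl⟩ := (h ▸ Set.mem_univ y : y ∈ Set.range s)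
          rw [hs, hs] at hxy
          rw [Subtype.ext hxy] }
    refine ⟨B, fun y => ⟨s y, y, rfl⟩, ?_, ?_⟩
    · funext ⟨x, y, hy⟩
      subst hy
      exact Subtype.ext (congrArg s (Subtype.ext (hs y)))
    · funext y
      exact Subtype.ext (hs y)

theorem rho_app_vertex (a : Sing X) (h : IsIdempotentElem a) :
    (rho a).app (rho a).vertex = 𝟙 _ := by
  funext ⟨x, y, hy⟩
  subst hy
  exact Subtype.ext (congrArg (fun b : Sing X => b.toFun y) h)

theorem exists_retraction (A : Pow X) : ∃ f : X → A.carrier, ∀ x : A.carrier, f x = x := by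
  classical
  obtain ⟨a, ha⟩ := A.nonempty
  exact ⟨fun x => if h : x ∈ A.carrier then ⟨x, h⟩ else ⟨a, ha⟩, fun x => by simp⟩

instance : IsNormalCategory (Pow X) where
  factorization {A B} f := by
    let g : A.carrier → X := fun x => f x
    let I : Pow X :=
      { carrier := Set.range g
        nonempty := A.nonempty.elim fun x hx => ⟨g ⟨x, hx⟩, _, rfl⟩
        ne_univ := fun h => B.ne_univ (Set.eq_univ_of_univ_subset (h ▸ by
          rintro _ ⟨x, rfl⟩
          exact (f x).2)) }
    let s : I.carrier → A.carrier := fun y => y.2.choose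
    have hs : ∀ y, g (s y) = y := fun y => y.2.choose_spec
    let J : Pow X :=
      { carrier := Set.range fun y => (s y : X)
        nonempty := I.nonempty.elim fun x hx => ⟨s ⟨x, hx⟩, _, rfl⟩
        ne_univ := fun h => A.ne_univ (Set.eq_univ_of_univ_subset (h ▸ by
          rintro _ ⟨x, rfl⟩
          exact (s x).2)) }
    have hJ : J.carrier ⊆ A.carrier := by
      rintro _ ⟨x, rfl⟩
      exact (s x).2
    exact ⟨{
      coimg := J
      img := I
      sub_coimg := hJ
      sub_img := by
        rintro _ ⟨x, rfl⟩
        exact (f x).2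
      e := fun x => ⟨s ⟨g x, x, rfl⟩, _, rfl⟩
      u :=
        { hom := fun x => ⟨g ⟨x, hJ x.2⟩, _, rfl⟩
          inv := fun y => ⟨s y, y, rfl⟩
          hom_inv_id := by
            funext ⟨x, y, hy⟩
            subst hy
            exact Subtype.ext (congrArg (fun z => (s z : X)) (Subtype.ext (hs y)))
          inv_hom_id := by
            funext y
            exact Subtype.ext (hs y) }
      retraction := by
        funext ⟨x, y, hy⟩
        subst hy
        exact Subtype.ext (congrArg (fun z => (s z : X)) (Subtype.ext (hs y)))
      fac := by
        funext x
        exact Subtype.ext (hs ⟨g x, x, rfl⟩) }⟩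
  splits {A _} _ := by
    obtain ⟨f, hf⟩ := A.exists_retraction
    exact ⟨fun x => f x, funext fun x => hf x⟩
  exists_cone A := by
    obtain ⟨f, hf⟩ := A.exists_retraction
    have h : (fun x : A.carrier => f x) = fun x => x := funext hf
    exact ⟨⟨⟨A, fun B x => f x, fun _ => rfl⟩, A, by
      change IsIso (C := Pow X) (X := A) (Y := A) fun x : A.carrier => f x
      rw [h]
      exact inferInstanceAs (IsIso (𝟙 A))⟩, rfl, h⟩

end Pow

/-! ## The category of partitions -/

/-- The objects of the category of partitions: the non-identity partitions `π` of `X`, given as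
equivalence relations; the blocks of the partition `p` are the elements of `Quotient p.rel`.
Its object is written `π̄` below. -/
@[ext]
structure Partn (X : Type u) where
  rel : Setoid X
  ne_bot : rel ≠ ⊥

namespace Partn

variable {X : Type u}

/-- A morphism from `π̄₁` to `π̄₂` is the map `η* : α ↦ η α` from `π̄₁` to `π̄₂` given by a function
`η` from `π₂` to `π₁`.  It is represented by `η`; by `star_injective` and `star_comp` below,
`η ↦ η*` is injective and compatible with the composition. -/
instance : Category.{u} (Partn X) where
  Hom p q := Quotient q.rel → Quotient p.rel
  id _ := fun c => c
  comp f g := fun c => f (g c)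

/-- The map `η*`. -/
def star {p q : Partn X} (η : p ⟶ q) (α : Quotient p.rel → X) : Quotient q.rel → X :=
  fun c => α (η c)

theorem star_injective [Nontrivial X] {p q : Partn X} {η η' : p ⟶ q} (h : star η = star η') :
    η = η' := by
  classical
  obtain ⟨x, y, hxy⟩ := exists_pair_ne X
  funext c
  by_contra hc
  have := congrFun (congrFun h fun d => if d = η c then x else y) c
  simp [star, Ne.symm hc, hxy] at this

theorem star_comp {p q r : Partn X} (η : p ⟶ q) (μ : q ⟶ r) (α : Quotient p.rel → X) :
    star (η ≫ μ) α = star μ (star η α) := rfl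

/-- `π̄₁ ≤ π̄₂` iff every block of `π₂` is contained in a block of `π₁`; the inclusion morphism is
then `ν*`, where `ν` takes each block of `π₂` to the block of `π₁` that contains it. -/
instance : SubobjectCategory (Partn X) where
  Sub p q := q.rel ≤ p.rel
  sub_refl _ := le_rfl
  sub_trans h h' := h'.trans h
  sub_antisymm h h' := Partn.ext (le_antisymm h' h)
  incl h := Quotient.map id fun _ _ k => h k
  incl_refl p := by
    funext c
    induction c using Quotient.inductionOn
    rfl
  incl_comp h h' := by
    funext c
    induction c using Quotient.inductionOn
    rfl
  incl_mono h := ⟨fun f g e => by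
    funext c
    induction c using Quotient.inductionOn with
    | h x => exact congrFun e (Quotient.mk _ x)⟩
  incl_factor {p q r} h h' f e := by
    have key : ∀ x : X, f (Quotient.mk q.rel x) = Quotient.mk p.rel x := fun x =>
      congrFun e (Quotient.mk r.rel x)
    refine ⟨fun x y hxy => ?_, ?_⟩
    · apply Quotient.exact
      rw [← key x, ← key y, Quotient.sound hxy]
    · funext c
      induction c using Quotient.inductionOn with
      | h x => exact key x

theorem nonempty (p : Partn X) : Nonempty X := by
  by_contra h
  rw [not_nonempty_iff] at h
  exact p.ne_bot (Setoid.ext fun x => h.elim x)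

theorem ne_bot_of_le {p : Partn X} {s : Setoid X} (h : p.rel ≤ s) : s ≠ ⊥ := fun e =>
  p.ne_bot (le_bot_iff.mp (e ▸ h))

instance : IsNormalCategory (Partn X) where
  factorization {p q} η := by
    classical
    let m : (s : Setoid X) → X → Quotient s := fun s => Quotient.mk s
    let g : X → Quotient p.rel := fun x => η (m q.rel x)
    have hg : ∀ c : Quotient q.rel, ∃ x, g x = η c := fun c => by
      induction c using Quotient.inductionOn with
      | h x => exact ⟨x, rfl⟩
    obtain ⟨x₀⟩ := p.nonempty
    let r : Quotient p.rel → Quotient p.rel := fun c => if ∃ x, g x = c then c else g x₀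
    have hr : ∀ c, ∃ x, g x = r c := fun c => by
      by_cases h : ∃ x, g x = c
      · simpa only [r, if_pos h] using h
      · exact ⟨x₀, by simp only [r, if_neg h]⟩
    have hrg : ∀ x, r (g x) = g x := fun x => if_pos ⟨x, rfl⟩
    let P : Partn X := ⟨Setoid.ker fun x => r (m p.rel x),
      ne_bot_of_le (p := p) fun x y h => congrArg r (Quotient.sound h)⟩
    have hP : Sub P p := fun x y h => congrArg r (Quotient.sound h)
    let Q : Partn X := ⟨Setoid.ker g,
      ne_bot_of_le (p := q) fun x y h => congrArg η (Quotient.sound h)⟩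
    have hQ : Sub Q q := fun x y h => congrArg η (Quotient.sound h)
    -- `z` is induced by `r`, and `n` is the projection of blocks
    let z : Quotient P.rel → Quotient p.rel := Quotient.lift (fun x => r (m p.rel x)) fun _ _ h => h
    let n : Quotient p.rel → Quotient P.rel := incl hP
    have hzn : ∀ c, z (n c) = r c := fun c => by
      induction c using Quotient.inductionOn
      rfl
    have hz : Function.Injective z := fun c d => by
      induction c using Quotient.inductionOn
      induction d using Quotient.inductionOn
      exact fun h => Quotient.sound h
    have hzr : ∀ c, r (z c) = z c := fun c => by
      induction c using Quotient.inductionOn with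
      | h x =>
        obtain ⟨y, hy⟩ := hr (m p.rel x)
        change r (r (m p.rel x)) = r (m p.rel x)
        rw [← hy, hrg]
    let gq : Quotient Q.rel → Quotient p.rel := Quotient.lift g fun _ _ h => h
    have hgq : Function.Injective gq := fun c d => by
      induction c using Quotient.inductionOn
      induction d using Quotient.inductionOn
      exact fun h => Quotient.sound h
    have hrgq : ∀ c, r (gq c) = gq c := fun c => by
      induction c using Quotient.inductionOn with
      | h x => exact hrg x
    have hinv : ∀ c : Quotient P.rel, ∃ d : Quotient Q.rel, gq d = z c := fun c => by
      induction c using Quotient.inductionOn with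
      | h x =>
        obtain ⟨y, hy⟩ := hr (m p.rel x)
        exact ⟨m _ y, hy⟩
    exact ⟨{
      coimg := P
      img := Q
      sub_coimg := hP
      sub_img := hQ
      e := z
      u :=
        { hom := fun c => n (gq c)
          inv := fun c => (hinv c).choose
          hom_inv_id := funext fun c => hz (by
            change z (n (gq (hinv c).choose)) = z c
            rw [hzn, hrgq, (hinv c).choose_spec])
          inv_hom_id := funext fun c => hgq (by
            change gq (hinv (n (gq c))).choose = gq c
            rw [(hinv _).choose_spec, hzn, hrgq]) }
      retraction := funext fun c => hz (by
        change z (n (z c)) = z c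
        rw [hzn, hzr])
      fac := funext fun c => by
        induction c using Quotient.inductionOn with
        | h x =>
          change z (n (g x)) = g x
          rw [hzn, hrg] }⟩
  splits _ :=
    ⟨fun c => Quotient.mk _ c.out, funext fun c => c.out_eq⟩
  exists_cone p := by
    have h : (fun c : Quotient p.rel => Quotient.mk p.rel c.out) = fun c => c :=
      funext fun c => c.out_eq
    exact ⟨⟨⟨p, fun q c => Quotient.mk q.rel c.out, fun _ => rfl⟩, p, by
      change IsIso (C := Partn X) (X := p) (Y := p) fun c => Quotient.mk p.rel c.out
      rw [h]
      exact inferInstanceAs (IsIso (𝟙 p))⟩, rfl, h⟩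

/-- The partition `π_a` determined by a singular transformation: `x` and `y` are in the same block
iff `a` takes the same value at them. -/
def ker (a : Sing X) : Partn X where
  rel := Setoid.ker a.toFun
  ne_bot h := a.not_injective ((Setoid.injective_iff_ker_bot _).mpr h)

variable (I : CatIdeal (Partn X))

/-- The cone `σ^a` with vertex `π̄_a` whose component at `π̄` is given by the map
`[x] ↦ [x a]` from `π_a` to `π`. -/
def sigmaCone (a : Sing X) (h : ker a ∈ I.carrier) : SubCone I.Obj where
  vertex := ⟨ker a, h⟩
  app p := Quotient.lift (fun x => Quotient.mk p.1.rel (a.toFun x)) fun _ _ k =>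
    congrArg (Quotient.mk p.1.rel) k
  compat k := by
    funext c
    induction c using Quotient.inductionOn
    rfl

theorem sigmaCone_app_vertex (e : Sing X) (h : ker e ∈ I.carrier) (he : IsIdempotentElem e) :
    (sigmaCone I e h).app (sigmaCone I e h).vertex = 𝟙 _ := by
  funext c
  induction c using Quotient.inductionOn with
  | h x => exact Quotient.sound (congrArg (fun b : Sing X => b.toFun x) he)

/-- The normal cone `σ^e` determined by an idempotent `e`. -/
def sigma (e : Sing X) (h : ker e ∈ I.carrier) (he : IsIdempotentElem e) : NormalCone I.Obj where
  toSubCone := sigmaCone I e h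
  normal := ⟨(sigmaCone I e h).vertex, by
    rw [sigmaCone_app_vertex I e h he]
    infer_instance⟩

theorem sigma_idem (e : Sing X) (h : ker e ∈ I.carrier) (he : IsIdempotentElem e) :
    IsIdempotentElem (sigma I e h he) :=
  NormalCone.mul_self_of_app _ (sigmaCone_app_vertex I e h he)

/-! ### The identification of the category of partitions with the normal dual of `Pow X` -/

/-- An idempotent `e` with `π_e = p`: it takes each element to a chosen element of its block. -/
noncomputable def idem (p : Partn X) : Sing X where
  toFun x := (Quotient.mk p.rel x).out
  not_injective h := p.ne_bot (Setoid.ext fun x y =>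
    ⟨fun k => h (congrArg Quotient.out (Quotient.sound k)), fun k => by
      rw [show x = y from k]⟩)
  not_surjective h := p.ne_bot (by
    have key : ∀ y : X, (Quotient.mk p.rel y).out = y := fun y => by
      obtain ⟨x, rfl⟩ := h y
      exact congrArg Quotient.out (Quotient.out_eq _)
    exact Setoid.ext fun x y => ⟨fun k => by
      have := congrArg Quotient.out (Quotient.sound k)
      rwa [key, key] at this, fun k => by rw [show x = y from k]⟩)

theorem idem_idem (p : Partn X) : IsIdempotentElem p.idem :=
  Sing.ext (funext fun _ => congrArg Quotient.out (Quotient.out_eq _))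

theorem rho_idem (p : Partn X) : IsIdempotentElem (Pow.rho p.idem) :=
  NormalCone.mul_self_of_app _ (Pow.rho_app_vertex _ p.idem_idem)

/-- The map from `Im f` to `Im e` determined by a function `η` from the blocks of `q = π_f` to the
blocks of `p = π_e`, where `e` and `f` are the chosen idempotents. -/
noncomputable def between {p q : Partn X} (η : p ⟶ q) :
    (Pow.rho q.idem).vertex ⟶ (Pow.rho p.idem).vertex :=
  fun y => ⟨(η (Quotient.mk q.rel y)).out, by
    obtain ⟨x, hx⟩ := (η (Quotient.mk q.rel y)).exists_rep
    exact ⟨x, congrArg Quotient.out hx⟩⟩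

theorem between_id (p : Partn X) : between (𝟙 p) = 𝟙 _ := by
  funext ⟨x, y, hy⟩
  subst hy
  exact Subtype.ext (congrArg Quotient.out (Quotient.out_eq _))

theorem between_comp {p q r : Partn X} (η : p ⟶ q) (μ : q ⟶ r) :
    between (η ≫ μ) = between μ ≫ between η := by
  funext y
  exact Subtype.ext (congrArg (fun c => (η c).out) (Quotient.out_eq _).symm)

variable (X) in
/-- The functor `Π(X) ⥤ N*𝒫(X)` through which `Π(X)` is identified with the normal dual of
`𝒫(X)`: it takes `π̄` to `H(e; -)`, where `e` is an idempotent with `π_e = π`, and `η*` to the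
natural transformation `a ↦ w a`, where `w : Im f → Im e` is the map induced by `η`. -/
noncomputable def toDual : Partn X ⥤ NormalDual (Pow X) where
  obj p := NormalDual.ofCone (Pow.rho p.idem) p.rho_idem
  map {p q} η := NormalDual.homOf p.rho_idem q.rho_idem (between η)
  map_id p := by rw [between_id, NormalDual.homOf_id]
  map_comp {p q r} η μ := by
    rw [between_comp, NormalDual.homOf_comp p.rho_idem q.rho_idem r.rho_idem]

/-- `I` is a total ideal: for every object `A` of `𝒫(X)` there is `π̄` in `I` such that `A` belongs to
the M-set of the corresponding H-functor. -/
def IsTotal : Prop := ∀ A : Pow X, ∃ p ∈ I.carrier, A ∈ ((toDual X).obj p).mSet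

/-- The inclusion functor `j(I, Π(X))`, as a functor from `I` to the normal dual of `𝒫(X)`. -/
noncomputable def gamma : I.Obj ⥤ NormalDual (Pow X) := I.inclusion ⋙ toDual X

/-- The morphism from `π̄_{e'}` to `π̄_e` in `I` given by the map `[x] ↦ [(x e) f]` from `π_e` to
`π_{e'}`. -/
def hat {e e' : Sing X} (h : ker e ∈ I.carrier) (he : IsIdempotentElem e)
    (h' : ker e' ∈ I.carrier) (he' : IsIdempotentElem e') (f : Pow.im e ⟶ Pow.im e') :
    (sigma I e' h' he').vertex ⟶ (sigma I e h he).vertex :=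
  Quotient.lift (fun x => Quotient.mk (ker e').rel (f ⟨e.toFun x, x, rfl⟩).1) fun x y k => by
    have : (⟨e.toFun x, x, rfl⟩ : (Pow.im e).carrier) = ⟨e.toFun y, y, rfl⟩ := Subtype.ext k
    change Quotient.mk _ (f ⟨e.toFun x, x, rfl⟩).1 = Quotient.mk _ (f ⟨e.toFun y, y, rfl⟩).1
    rw [this]

/-- `Δ` is the identity functor of `𝒫(X)`, when the H-functors `H(σ^e; -)` in `N*I` are identified with
the sets `Im e`, and the natural transformations between them with the maps between these sets:
`Δ(Im e) = H(σ^e; -)` for each idempotent `e` with `π̄_e` in `I`, and for `f : Im e → Im e'`, `Δ(f)` is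
the natural transformation `σ^e * g° ↦ σ^{e'} * (f̂ g)°`, where `f̂ : π̄_{e'} → π̄_e` is given by `f`. -/
structure IsIdentity (Δ : Pow X ⥤ NormalDual I.Obj) : Prop where
  obj : ∀ (e : Sing X) (h : ker e ∈ I.carrier) (he : IsIdempotentElem e),
    Δ.obj (Pow.im e) = NormalDual.ofCone (sigma I e h he) (sigma_idem I e h he)
  map : ∀ (e e' : Sing X) (h : ker e ∈ I.carrier) (he : IsIdempotentElem e)
    (h' : ker e' ∈ I.carrier) (he' : IsIdempotentElem e') (f : Pow.im e ⟶ Pow.im e')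
    (p : I.Obj) (g : (sigma I e h he).vertex ⟶ p)
    (hg : (sigma I e h he).star g ∈ (Δ.obj (Pow.im e)).obj p),
    (NormalDual.Hom.app (Δ.map f) p ⟨_, hg⟩ : NormalCone I.Obj) =
      (sigma I e' h' he').star (hat I h he h' he' f ≫ g)

/-- The subsemigroup `{a ∈ Sing(X) : π̄_a ∈ I}` of `Sing(X)`. -/
def singSub : Subsemigroup (Sing X) where
  carrier := {a | ker a ∈ I.carrier}
  mul_mem' {a b} ha _ := I.down (d := ker a) (fun _ _ k => congrArg b.toFun k) ha

end Partn

/-- Regular semigroups. -/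
def IsRegularSemigroup (S : Type u) [Semigroup S] : Prop := ∀ a : S, ∃ b : S, a * b * a = a

/-- Right reductive semigroups: the right regular representation, which takes `a` to the right
translation `x ↦ x a`, is injective. -/
def IsRightReductive (S : Type u) [Semigroup S] : Prop :=
  Function.Injective fun (a : S) (x : S) => x * a

end CrossConnection

/-!
A map `j : X/p → A` amounts to the transformation `a : x ↦ j [x]`, which is constant on the blocks
of `p` and takes its values in `A`. Taking `j` to `ρ^a` identifies these maps with `Γ(A, p)`; taking
`j` to `σ^a` identifies them with `Δ(A, p)`, where `Δ(A) = H(σ^e; -)` for any idempotent `e` with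
image `A`. Under both identifications `A` is in the M-set of `Γ(p)`, and `p` in that of `Δ(A)`,
exactly if `A` is a transversal of `p`, so `ρ^a ↦ σ^a` is a duality whose linked pairs are the pairs
`(ρ^a, σ^a)`. The dual is unique because any dual preserves inclusions: the cones `δ(A, p)` and
`δ(B, q)` induce the same cone at a point `x` of `A` and `B`, hence, if `B` is a transversal of `q`,
the component of `δ(A, p)` at `q` takes the block of `x` to the block of `x`.
-/

namespace CrossConnection

open SubobjectCategory

namespace NormalCone

variable {C : Type u} [SubobjectCategory C] {γ δ : NormalCone C}

theorem hom_ext {d : C} {f g : γ.vertex ⟶ d} (h : ∀ c, γ.app c ≫ f = γ.app c ≫ g) : f = g := by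
  obtain ⟨c, hc⟩ := γ.normal
  exact (cancel_epi (γ.app c)).mp (h c)

theorem isIso_of_app_comp {f : γ.vertex ⟶ δ.vertex} {g : δ.vertex ⟶ γ.vertex}
    (hf : ∀ c, γ.app c ≫ f = δ.app c) (hg : ∀ c, δ.app c ≫ g = γ.app c) : IsIso f :=
  ⟨g, hom_ext fun c => by rw [← Category.assoc, hf, hg, Category.comp_id],
    hom_ext fun c => by rw [← Category.assoc, hg, hf, Category.comp_id]⟩

theorem sub_vertex_of_app_comp_incl {d : C} (h : Sub γ.vertex d) (k : Sub δ.vertex d)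
    (e : ∀ c, γ.app c ≫ incl h = δ.app c ≫ incl k) : Sub γ.vertex δ.vertex := by
  obtain ⟨c, hc⟩ := γ.normal
  obtain ⟨s, -⟩ := incl_factor h k (inv (γ.app c) ≫ δ.app c) (by
    rw [Category.assoc, ← e, IsIso.inv_hom_id_assoc])
  exact s

theorem eq_iff_app_comp_incl {d : C} (h : Sub γ.vertex d) (k : Sub δ.vertex d) :
    γ = δ ↔ ∀ c, γ.app c ≫ incl h = δ.app c ≫ incl k := by
  constructor
  · rintro rfl c
    rfl
  · intro e
    have hv : γ.vertex = δ.vertex := sub_antisymm (sub_vertex_of_app_comp_incl h k e)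
      (sub_vertex_of_app_comp_incl k h fun c => (e c).symm)
    refine NormalCone.ext' hv fun c => ?_
    rw [← cancel_mono (incl k), Category.assoc, eqToHom_incl, e]

variable [IsNormalCategory C]

theorem star_eq_of_app_comp_incl {d : C} {f : γ.vertex ⟶ d} (h : Sub δ.vertex d)
    (e : ∀ c, γ.app c ≫ f = δ.app c ≫ incl h) : γ.star f = δ := by
  obtain ⟨k, hk⟩ := γ.star_spec f
  exact (eq_iff_app_comp_incl k h).mpr fun c => (hk c).trans (e c)

theorem star_eq_star_iff {d : C} {f : γ.vertex ⟶ d} {g : δ.vertex ⟶ d} :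
    γ.star f = δ.star g ↔ ∀ c, γ.app c ≫ f = δ.app c ≫ g := by
  obtain ⟨h, e⟩ := γ.star_spec f
  obtain ⟨h', e'⟩ := δ.star_spec g
  rw [eq_iff_app_comp_incl h h']
  simp only [e, e']

theorem star_eq_iff {f : γ.vertex ⟶ δ.vertex} : γ.star f = δ ↔ ∀ c, γ.app c ≫ f = δ.app c := by
  simpa only [δ.star_id, Category.comp_id] using star_eq_star_iff (f := f) (g := 𝟙 δ.vertex)

theorem isIdempotentElem_iff : IsIdempotentElem γ ↔ γ.app γ.vertex = 𝟙 _ :=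
  ⟨fun h => γ.star_injective (h.trans γ.star_id.symm), γ.mul_self_of_app⟩

end NormalCone

theorem IsLocalIso.of_bijective_map {C D : Type u} [SubobjectCategory C] [SubobjectCategory D]
    {F : C ⥤ D}
    (map_incl : ∀ {c d : C} (h : Sub c d), ∃ k : Sub (F.obj c) (F.obj d), F.map (incl h) = incl k)
    (bijective_map : ∀ c d : C, Function.Bijective (F.map : (c ⟶ d) → _))
    (exists_obj_eq : ∀ (c : C) (b : D), Sub b (F.obj c) → ∃ a, Sub a c ∧ F.obj a = b) :
    IsLocalIso F := by
  have sub_of_obj_eq : ∀ {a b c : C}, Sub a c → Sub b c → F.obj a = F.obj b → Sub a b := by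
    intro a b c ha hb e
    obtain ⟨k, hk⟩ := map_incl ha
    obtain ⟨k', hk'⟩ := map_incl hb
    obtain ⟨f, hf⟩ := (bijective_map a b).surjective (eqToHom e)
    obtain ⟨s, -⟩ := incl_factor ha hb f ((bijective_map a c).injective (by
      rw [F.map_comp, hf, hk, hk', eqToHom_incl]))
    exact s
  refine ⟨map_incl, ⟨(bijective_map _ _).surjective⟩, ⟨fun h => (bijective_map _ _).injective h⟩,
    fun c => ⟨fun a ha => (map_incl ha).1, fun a ha b hb e => ?_, exists_obj_eq c⟩⟩
  exact sub_antisymm (sub_of_obj_eq ha hb e) (sub_of_obj_eq hb ha e.symm)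

namespace NormalDual

variable {C : Type u} [SubobjectCategory C] [IsNormalCategory C]

theorem functor_ext {B : Type u} [Category.{u} B] {F G : B ⥤ NormalDual C}
    (hobj : ∀ b, F.obj b = G.obj b)
    (hmap : ∀ {b b' : B} (f : b ⟶ b') (c : C) (x : (F.obj b).obj c) (y : (G.obj b).obj c),
      x.1 = y.1 → (Hom.app (F.map f) c x).1 = (Hom.app (G.map f) c y).1) : F = G := by
  have heq_of_val_eq : ∀ {P P' Q Q' : NormalDual C} (η : P ⟶ Q) (η' : P' ⟶ Q'), P = P' → Q = Q' →
      (∀ (c : C) (x : P.obj c) (y : P'.obj c), x.1 = y.1 →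
        (Hom.app η c x).1 = (Hom.app η' c y).1) → HEq η η' := by
    rintro P _ Q _ η η' rfl rfl h
    exact heq_of_eq (Hom.ext (funext₂ fun c x => Subtype.ext (h c x x rfl)))
  exact CategoryTheory.Functor.hext hobj fun b b' f =>
    heq_of_val_eq _ _ (hobj b) (hobj b') (hmap f)

section OfCone

variable {ε ε' : NormalCone C} {h : IsIdempotentElem ε} {h' : IsIdempotentElem ε'}

variable (h) in
/-- The Yoneda bijection `f ↦ ε * f°` from `C(c_ε, c)` onto `H(ε; c)`. -/
noncomputable def objEquiv (c : C) : (ε.vertex ⟶ c) ≃ (ofCone ε h).obj c :=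
  Equiv.ofBijective (fun f => ⟨ε.star f, f, rfl⟩)
    ⟨fun _ _ e => ε.star_injective (congrArg Subtype.val e), fun ⟨_, f, hf⟩ => ⟨f, Subtype.ext hf⟩⟩

theorem map_objEquiv {c d : C} (g : c ⟶ d) (f : ε.vertex ⟶ c) :
    (ofCone ε h).map g (objEquiv h c f) = objEquiv h d (f ≫ g) :=
  hMap_star ε g f

theorem homOf_app_objEquiv (w : ε'.vertex ⟶ ε.vertex) {c : C} (f : ε.vertex ⟶ c) :
    Hom.app (homOf h h' w) c (objEquiv h c f) = objEquiv h' c (w ≫ f) :=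
  homOf_star h h' w f

theorem homOf_bijective :
    Function.Bijective (homOf h h' : (ε'.vertex ⟶ ε.vertex) → (ofCone ε h ⟶ ofCone ε' h')) := by
  constructor
  · intro w v e
    have := congrArg (fun η => Hom.app η ε.vertex (objEquiv h _ (𝟙 _))) e
    simpa only [homOf_app_objEquiv, Category.comp_id, EmbeddingLike.apply_eq_iff_eq] using this
  · intro η
    obtain ⟨w, hw⟩ := (objEquiv h' _).surjective (Hom.app η ε.vertex (objEquiv h _ (𝟙 _)))
    refine ⟨w, Hom.ext (funext₂ fun c x => ?_)⟩
    obtain ⟨f, rfl⟩ := (objEquiv h c).surjective x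
    calc Hom.app (homOf h h' w) c (objEquiv h c f) = (ofCone ε' h').map f (objEquiv h' _ w) := by
          rw [homOf_app_objEquiv, map_objEquiv]
      _ = Hom.app η c ((ofCone ε h).map f (objEquiv h _ (𝟙 _))) := by rw [hw, Hom.naturality]
      _ = Hom.app η c (objEquiv h c f) := by rw [map_objEquiv, Category.id_comp]

theorem exists_homOf_eq_incl (w : ε'.vertex ⟶ ε.vertex) (hw : ∀ c, ε'.app c ≫ w = ε.app c) :
    ∃ k : Sub (ofCone ε h) (ofCone ε' h'), homOf h h' w = incl k := by
  have star_comp : ∀ {c : C} (f : ε.vertex ⟶ c), ε'.star (w ≫ f) = ε.star f := fun f =>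
    NormalCone.star_eq_star_iff.mpr fun c => by rw [← Category.assoc, hw]
  have app_val : ∀ (c : C) (x : (ofCone ε h).obj c), (Hom.app (homOf h h' w) c x).1 = x.1 := by
    rintro c ⟨_, f, rfl⟩
    exact (congrArg Subtype.val (homOf_star h h' w f)).trans (star_comp f)
  have subset : ∀ c, (ofCone ε h).obj c ⊆ (ofCone ε' h').obj c := by
    rintro c _ ⟨f, rfl⟩
    exact ⟨w ≫ f, star_comp f⟩
  have app_eq : ∀ (c : C) (x : (ofCone ε h).obj c),
      Hom.app (homOf h h' w) c x = ⟨x, subset c x.2⟩ := fun c x => Subtype.ext (app_val c x)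
  refine ⟨⟨subset, fun {c d} g x => ?_⟩, Hom.ext (funext₂ app_eq)⟩
  rw [← app_eq, ← Hom.naturality, app_val]

theorem ofCone_eq_of_app_comp {w : ε'.vertex ⟶ ε.vertex} {v : ε.vertex ⟶ ε'.vertex}
    (hw : ∀ c, ε'.app c ≫ w = ε.app c) (hv : ∀ c, ε.app c ≫ v = ε'.app c) :
    ofCone ε h = ofCone ε' h' :=
  sub_antisymm (exists_homOf_eq_incl w hw).1 (exists_homOf_eq_incl v hv).1

theorem ofCone_congr (e : ε = ε') : ofCone ε h = ofCone ε' h' := by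
  subst e
  rfl

theorem self_mem_obj_vertex : ε ∈ (ofCone ε h).obj ε.vertex := ⟨𝟙 _, ε.star_id⟩

theorem map_val_eq_star {F : NormalDual C} (e : F = ofCone ε h) {c : C} (f : ε.vertex ⟶ c)
    (x : F.obj ε.vertex) (hx : x.1 = ε) : (F.map f x).1 = ε.star f := by
  subst e
  have hx : x = objEquiv h _ (𝟙 _) := Subtype.ext (hx.trans ε.star_id.symm)
  rw [hx, map_objEquiv, Category.id_comp]
  rfl

theorem exists_app_comp_of_sub (k : Sub (ofCone ε h) (ofCone ε' h')) :
    ∃ w : ε'.vertex ⟶ ε.vertex, ∀ c, ε'.app c ≫ w = ε.app c := by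
  obtain ⟨w, hw⟩ := k.1 ε.vertex self_mem_obj_vertex
  exact ⟨w, NormalCone.star_eq_iff.mp hw⟩

theorem mem_mSet_ofCone {c : C} : c ∈ (ofCone ε h).mSet ↔ IsIso (ε.app c) := by
  constructor
  · rintro ⟨ε', h', e, hc⟩
    have e : ofCone ε h = ofCone ε' h' := ext_cf e
    have hc : IsIso (ε'.app c) := hc
    obtain ⟨w, hw⟩ := exists_app_comp_of_sub (h := h) (h' := h') (e ▸ sub_refl _)
    obtain ⟨v, hv⟩ := exists_app_comp_of_sub (h := h') (h' := h) (e ▸ sub_refl _)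
    have : IsIso w := NormalCone.isIso_of_app_comp hw hv
    rw [← hw]
    infer_instance
  · intro hc
    exact ⟨ε, h, rfl, hc⟩

end OfCone

theorem exists_eq_ofCone (F : NormalDual C) :
    ∃ (ε : NormalCone C) (h : IsIdempotentElem ε), F = ofCone ε h := by
  obtain ⟨ε, h, e⟩ := F.isH
  exact ⟨ε, h, ext_cf e⟩

theorem exists_eq_ofCone_of_mem_mSet {F : NormalDual C} {c : C} (hc : c ∈ F.mSet) :
    ∃ (γ : NormalCone C) (h : IsIdempotentElem γ), γ.vertex = c ∧ F = ofCone γ h := by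
  obtain ⟨ε, h, rfl⟩ := F.exists_eq_ofCone
  have hc := mem_mSet_ofCone.mp hc
  let γ : NormalCone C :=
    { vertex := c
      app := fun d => ε.app d ≫ inv (ε.app c)
      compat := fun k => by rw [← Category.assoc, ε.compat]
      normal := ⟨c, inferInstance⟩ }
  have hγ : IsIdempotentElem γ := NormalCone.isIdempotentElem_iff.mpr (IsIso.hom_inv_id (ε.app c))
  have γ_app_comp : ∀ d, γ.app d ≫ ε.app c = ε.app d := fun d =>
    (Category.assoc _ _ _).trans (by rw [IsIso.inv_hom_id, Category.comp_id])
  exact ⟨γ, hγ, rfl, ofCone_eq_of_app_comp γ_app_comp fun _ => rfl⟩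

theorem exists_eq_ofCone_of_sub {F G : NormalDual C} (k : Sub F G) :
    ∃ (ε : NormalCone C) (h : IsIdempotentElem ε) (c : C), F = ofCone ε h ∧ ε ∈ G.obj c := by
  obtain ⟨ε, h, rfl⟩ := F.exists_eq_ofCone
  exact ⟨ε, h, _, rfl, k.1 _ self_mem_obj_vertex⟩

end NormalDual


theorem Sing.nontrivial {X : Type u} (a : Sing X) : Nontrivial X :=
  not_subsingleton_iff_nontrivial.mp fun _ =>
    a.not_injective (Function.injective_of_subsingleton a.toFun)

theorem Sing.isIdempotentElem_iff {X : Type u} {a : Sing X} :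
    IsIdempotentElem a ↔ ∀ x, a.toFun (a.toFun x) = a.toFun x :=
  ⟨fun h x => congrFun (congrArg Sing.toFun h) x, fun h => Sing.ext (funext h)⟩

namespace Pow

variable {X : Type u}

theorem isIso_iff_bijective {A B : Pow X} (f : A ⟶ B) :
    IsIso f ↔ Function.Bijective (f : A.carrier → B.carrier) := by
  rw [Function.bijective_iff_has_inverse]
  exact ⟨fun _ => ⟨inv f, congrFun (IsIso.hom_inv_id f), congrFun (IsIso.inv_hom_id f)⟩,
    fun ⟨g, hfg, hgf⟩ => ⟨g, funext hfg, funext hgf⟩⟩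

/-- A singleton, as an object of `𝒫(X)`. -/
def singleton [Nontrivial X] (x : X) : Pow X :=
  ⟨{x}, Set.singleton_nonempty x, Set.singleton_ne_univ x⟩

theorem app_eq_of_eq {γ δ : NormalCone (Pow X)} (h : γ = δ) {A : Pow X} (x : A.carrier) :
    (γ.app A x : X) = δ.app A x := by
  subst h
  rfl

theorem rho_injective : Function.Injective (rho (X := X)) := fun a b h => by
  have := a.nontrivial
  exact Sing.ext (funext fun x => app_eq_of_eq h (A := singleton x) ⟨x, rfl⟩)

theorem rho_star_eq {a b : Sing X} {A : Pow X} {f : (rho a).vertex ⟶ A}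
    (h : ∀ x, (f ⟨a.toFun x, x, rfl⟩ : X) = b.toFun x) : (rho a).star f = rho b := by
  have im_subset : Sub (im b) A := by
    rintro _ ⟨x, rfl⟩
    rw [← h]
    exact (f _).2
  exact NormalCone.star_eq_of_app_comp_incl (δ := rho b) im_subset fun B =>
    funext fun x => Subtype.ext (h x)

theorem rho_mul (a b : Sing X) : rho a * rho b = rho (a * b) :=
  rho_star_eq (f := (rho b).app (rho a).vertex) fun _ => rfl

theorem rho_isIdempotentElem_iff {a : Sing X} : IsIdempotentElem (rho a) ↔ IsIdempotentElem a := by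
  rw [IsIdempotentElem, rho_mul, rho_injective.eq_iff, IsIdempotentElem]

end Pow

namespace Partn

variable {X : Type u}

/-! ### Transformations as maps from blocks to subsets -/

/-- The transformation `x ↦ j [x]` determined by a map `j` from the blocks of `p` to `A`: it is
constant on the blocks of `p` and takes its values in `A`. -/
def toSing {p : Partn X} {A : Pow X} (j : Quotient p.rel → A.carrier) : Sing X where
  toFun x := j (Quotient.mk p.rel x)
  not_injective h := p.ne_bot <| le_bot_iff.mp fun _ _ e =>
    h (congrArg (fun c => (j c : X)) (Quotient.sound e))
  not_surjective h := A.ne_univ (Set.eq_univ_of_forall fun y => by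
    obtain ⟨x, rfl⟩ := h y
    exact (j _).2)

theorem sub_ker_toSing {p : Partn X} {A : Pow X} (j : Quotient p.rel → A.carrier) :
    Sub (ker (toSing j)) p :=
  fun _ _ e => congrArg (fun c => (j c : X)) (Quotient.sound e)

theorem im_toSing_sub {p : Partn X} {A : Pow X} (j : Quotient p.rel → A.carrier) :
    Sub (Pow.im (toSing j)) A := by
  rintro _ ⟨x, rfl⟩
  exact (j _).2

/-- The bijection from the blocks of `π_a` onto `Im a` induced by `a`. -/
noncomputable def blocksEquivIm (a : Sing X) : Quotient (ker a).rel ≃ (Pow.im a).carrier :=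
  Setoid.quotientKerEquivRange a.toFun

theorem blocksEquivIm_mk (a : Sing X) (x : X) :
    blocksEquivIm a (Quotient.mk (ker a).rel x) = ⟨a.toFun x, x, rfl⟩ := rfl

theorem toSing_blocksEquivIm (a : Sing X) : toSing (blocksEquivIm a) = a := rfl

/-! ### Transversals -/

/-- `A` is a transversal of the partition `p`: it meets each block in exactly one element. -/
def IsTransversal (p : Partn X) (A : Pow X) : Prop :=
  Function.Bijective fun x : A.carrier => Quotient.mk p.rel x.1

namespace IsTransversal

variable {p : Partn X} {A : Pow X}

/-- The bijection from a transversal onto the blocks; its inverse picks the representative of a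
block in the transversal. -/
noncomputable def equiv (h : IsTransversal p A) : A.carrier ≃ Quotient p.rel :=
  Equiv.ofBijective _ h

theorem equiv_apply (h : IsTransversal p A) (x : A.carrier) : h.equiv x = Quotient.mk p.rel x.1 :=
  rfl

theorem mk_equiv_symm (h : IsTransversal p A) (c : Quotient p.rel) :
    Quotient.mk p.rel (h.equiv.symm c).1 = c :=
  h.equiv.apply_symm_apply c

theorem equiv_symm_mk (h : IsTransversal p A) (x : A.carrier) :
    h.equiv.symm (Quotient.mk p.rel x.1) = x :=
  h.equiv.symm_apply_apply x

theorem toSing_equiv_symm_apply (h : IsTransversal p A) (x : A.carrier) :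
    (toSing h.equiv.symm).toFun x = x :=
  congrArg Subtype.val (h.equiv_symm_mk x)

theorem isIdempotentElem_toSing (h : IsTransversal p A) :
    IsIdempotentElem (toSing h.equiv.symm) :=
  Sing.isIdempotentElem_iff.mpr fun _ => h.toSing_equiv_symm_apply _

theorem ker_toSing (h : IsTransversal p A) : ker (toSing h.equiv.symm) = p :=
  sub_antisymm (sub_ker_toSing _) fun _ _ e =>
    Quotient.exact (h.equiv.symm.injective (Subtype.ext e))

theorem im_toSing (h : IsTransversal p A) : Pow.im (toSing h.equiv.symm) = A :=
  sub_antisymm (im_toSing_sub _) fun x hx => ⟨x, h.toSing_equiv_symm_apply ⟨x, hx⟩⟩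

end IsTransversal

theorem isTransversal_ker_im {e : Sing X} (he : IsIdempotentElem e) :
    IsTransversal (ker e) (Pow.im e) := by
  rw [Sing.isIdempotentElem_iff] at he
  constructor
  · rintro ⟨_, x, rfl⟩ ⟨_, y, rfl⟩ h
    have : e.toFun (e.toFun x) = e.toFun (e.toFun y) := Quotient.exact h
    rw [he, he] at this
    exact Subtype.ext this
  · intro c
    induction c using Quotient.inductionOn with
    | h x => exact ⟨⟨e.toFun x, x, rfl⟩, Quotient.sound (he x)⟩

theorem exists_isTransversal_mem (p : Partn X) (x : X) :
    ∃ A : Pow X, x ∈ A.carrier ∧ IsTransversal p A := by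
  classical
  let r : Quotient p.rel → X := Function.update Quotient.out (Quotient.mk p.rel x) x
  have mk_r : ∀ c, Quotient.mk p.rel (r c) = c := fun c => by
    by_cases h : c = Quotient.mk p.rel x
    · simp only [r, h, Function.update_self]
    · simp only [r, Function.update_of_ne h, Quotient.out_eq]
  have range_ne_univ : Set.range r ≠ Set.univ := fun h => p.ne_bot <| le_bot_iff.mp fun y z e => by
    obtain ⟨c, rfl⟩ := Set.range_eq_univ.mp h y
    obtain ⟨d, rfl⟩ := Set.range_eq_univ.mp h z
    have : c = d := by rw [← mk_r c, ← mk_r d, Quotient.sound e]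
    rw [this]
  refine ⟨⟨Set.range r, ⟨x, Quotient.mk p.rel x, Function.update_self ..⟩, range_ne_univ⟩,
    ⟨Quotient.mk p.rel x, Function.update_self ..⟩, ?_, fun c => ⟨⟨r c, c, rfl⟩, mk_r c⟩⟩
  rintro ⟨_, c, rfl⟩ ⟨_, d, rfl⟩ h
  have : c = d := (mk_r c).symm.trans (Eq.trans h (mk_r d))
  rw [this]

/-! ### The H-functors of the cones of transformations -/

theorem mk_idem_apply (p : Partn X) (x : X) :
    Quotient.mk p.rel (p.idem.toFun x) = Quotient.mk p.rel x :=
  Quotient.out_eq _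

theorem ker_idem (p : Partn X) : ker p.idem = p :=
  sub_antisymm (fun _ _ e => congrArg Quotient.out (Quotient.sound e)) fun x y e => by
    apply Quotient.exact
    rw [← mk_idem_apply, ← mk_idem_apply p y]
    exact congrArg _ e

theorem isTransversal_im_idem (p : Partn X) : IsTransversal p (Pow.im p.idem) := by
  simpa only [ker_idem] using isTransversal_ker_im p.idem_idem

theorem between_eq_arrowCongr {p q : Partn X} (η : p ⟶ q) :
    between η = Equiv.arrowCongr q.isTransversal_im_idem.equiv.symm
      p.isTransversal_im_idem.equiv.symm η := by
  have equiv_symm_val : ∀ c, (p.isTransversal_im_idem.equiv.symm c).1 = c.out := fun c => by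
    obtain ⟨⟨_, x, rfl⟩, rfl⟩ := p.isTransversal_im_idem.equiv.surjective c
    rw [Equiv.symm_apply_apply, IsTransversal.equiv_apply, mk_idem_apply]
    rfl
  exact funext fun y => Subtype.ext (equiv_symm_val _).symm

theorem between_bijective {p q : Partn X} :
    Function.Bijective (between : (p ⟶ q) → _) := by
  rw [show between = _ from funext between_eq_arrowCongr]
  exact Equiv.bijective _

theorem rho_idem_app_comp_between_incl {p q : Partn X} (h : Sub p q) (A : Pow X) :
    (Pow.rho q.idem).app A ≫ between (incl h) = (Pow.rho p.idem).app A :=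
  funext fun x => Subtype.ext
    (congrArg (fun c => Quotient.out (incl h c)) (q.mk_idem_apply x.1))

theorem mem_mSet_toDual {p : Partn X} {A : Pow X} :
    A ∈ ((toDual X).obj p).mSet ↔ IsTransversal p A := by
  rw [show A ∈ ((toDual X).obj p).mSet ↔ _ from NormalDual.mem_mSet_ofCone (h := p.rho_idem),
    Pow.isIso_iff_bijective]
  have app_eq : p.isTransversal_im_idem.equiv ∘ (Pow.rho p.idem).app A =
      fun x : A.carrier => Quotient.mk p.rel x.1 := funext fun x => p.mk_idem_apply x.1
  rw [IsTransversal, ← app_eq]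
  exact (p.isTransversal_im_idem.equiv.bijective.of_comp_iff' _).symm

theorem toDual_obj_eq_ofCone {p : Partn X} {e : Sing X} (he : IsIdempotentElem e)
    (hk : ker e = p) :
    (toDual X).obj p = NormalDual.ofCone (Pow.rho e) (Pow.rho_isIdempotentElem_iff.mpr he) := by
  subst hk
  have apply_idem : ∀ x, e.toFun ((ker e).idem.toFun x) = e.toFun x := fun x =>
    Quotient.exact (mk_idem_apply (ker e) x)
  have idem_apply : ∀ x, (ker e).idem.toFun (e.toFun x) = (ker e).idem.toFun x := fun x =>
    congrArg Quotient.out (Quotient.sound (Sing.isIdempotentElem_iff.mp he x))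
  exact NormalDual.ofCone_eq_of_app_comp (h := rho_idem _)
    (w := fun y => ⟨(ker e).idem.toFun y.1, _, rfl⟩) (v := fun y => ⟨e.toFun y.1, _, rfl⟩)
    (fun A => funext fun x => Subtype.ext (idem_apply x.1))
    fun A => funext fun x => Subtype.ext (apply_idem x.1)

/-- The bijection from the maps `X/p → A` onto `H(ρ^e; A)`, where `e` is the chosen idempotent with
`π_e = p`: it takes `j` to `ρ^a`, where `a` is the transformation `x ↦ j [x]`. -/
noncomputable def toDualEquiv (p : Partn X) (A : Pow X) :
    (Quotient p.rel → A.carrier) ≃ ((toDual X).obj p).obj A :=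
  Equiv.trans (β := (Pow.rho p.idem).vertex ⟶ A)
    (Equiv.arrowCongr p.isTransversal_im_idem.equiv.symm (Equiv.refl _))
    (NormalDual.objEquiv p.rho_idem A)

theorem toDualEquiv_val {p : Partn X} {A : Pow X} (j : Quotient p.rel → A.carrier) :
    (toDualEquiv p A j).1 = Pow.rho (toSing j) :=
  Pow.rho_star_eq fun x => congrArg (fun c => (j c).1) (p.mk_idem_apply x)

theorem exists_eq_rho_toSing {p : Partn X} {A : Pow X} {γ : NormalCone (Pow X)}
    (hγ : γ ∈ ((toDual X).obj p).obj A) :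
    ∃ j : Quotient p.rel → A.carrier, γ = Pow.rho (toSing j) := by
  obtain ⟨j, hj⟩ := (toDualEquiv p A).surjective ⟨γ, hγ⟩
  exact ⟨j, by rw [← toDualEquiv_val, hj]⟩

theorem toDual_obj_map_toDualEquiv {p : Partn X} {A B : Pow X} (f : A ⟶ B)
    (j : Quotient p.rel → A.carrier) :
    ((toDual X).obj p).map f (toDualEquiv p A j) = toDualEquiv p B fun c => f (j c) :=
  NormalDual.map_objEquiv _ _

theorem toDual_map_app_toDualEquiv {p q : Partn X} (η : p ⟶ q) {A : Pow X}
    (j : Quotient p.rel → A.carrier) :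
    NormalDual.Hom.app ((toDual X).map η) A (toDualEquiv p A j) =
      toDualEquiv q A fun c => j (η c) := by
  refine (NormalDual.homOf_app_objEquiv _ _).trans
    (congrArg (NormalDual.objEquiv q.rho_idem A) (funext fun y => ?_))
  exact congrArg j (Quotient.out_eq _)

variable {I : CatIdeal (Partn X)}

theorem leftMap_gamma {A B : Pow X} {p q : I.Obj} (f : A ⟶ B) (η : p ⟶ q)
    (j : Quotient p.1.rel → A.carrier) :
    leftMap (gamma I) f η (toDualEquiv p.1 A j) = toDualEquiv q.1 B fun c => f (j (η c)) :=
  (congrArg (NormalDual.Hom.app ((toDual X).map η) B) (toDual_obj_map_toDualEquiv f j)).trans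
    (toDual_map_app_toDualEquiv _ _)

variable (I) in
theorem gamma_isLocalIso : IsLocalIso (gamma I) := by
  refine IsLocalIso.of_bijective_map
    (fun h => NormalDual.exists_homOf_eq_incl _ (rho_idem_app_comp_between_incl h))
    (fun p q => NormalDual.homOf_bijective.comp between_bijective) fun p F hF => ?_
  obtain ⟨ε, hε, A, rfl, hmem⟩ := NormalDual.exists_eq_ofCone_of_sub hF
  obtain ⟨j, rfl⟩ := exists_eq_rho_toSing hmem
  exact ⟨⟨ker (toSing j), I.down (sub_ker_toSing j) p.2⟩, sub_ker_toSing j,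
    toDual_obj_eq_ofCone (Pow.rho_isIdempotentElem_iff.mp hε) rfl⟩

theorem IsTotal.exists_isTransversal (hI : IsTotal I) (A : Pow X) :
    ∃ p : I.Obj, IsTransversal p.1 A := by
  obtain ⟨p, hp, h⟩ := hI A
  exact ⟨⟨p, hp⟩, mem_mSet_toDual.mp h⟩

theorem gamma_isCrossConnection (hI : IsTotal I) : IsCrossConnection (gamma I) :=
  ⟨gamma_isLocalIso I, fun A => (hI.exists_isTransversal A).imp fun _ => mem_mSet_toDual.mpr⟩

/-! ### The cones `σ^a` of an ideal -/

theorem isIso_iff_bijective {p q : I.Obj} (η : p ⟶ q) :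
    IsIso η ↔ Function.Bijective (η : Quotient q.1.rel → Quotient p.1.rel) := by
  rw [Function.bijective_iff_has_inverse]
  exact ⟨fun _ => ⟨inv η, congrFun (IsIso.inv_hom_id η), congrFun (IsIso.hom_inv_id η)⟩,
    fun ⟨μ, hμη, hημ⟩ => ⟨μ, funext hημ, funext hμη⟩⟩

/-- The transformation `x ↦ j [x]`, as an element of the semigroup `S` of an ideal containing the
partition `p`. -/
def toSingSub {p : I.Obj} {A : Pow X} (j : Quotient p.1.rel → A.carrier) : singSub I :=
  ⟨toSing j, I.down (sub_ker_toSing j) p.2⟩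

theorem sigmaCone_app (a : Sing X) (h : ker a ∈ I.carrier) (q : I.Obj)
    (c : Quotient (ker a).rel) :
    (sigmaCone I a h).app q c = Quotient.mk q.1.rel (blocksEquivIm a c).1 := by
  induction c using Quotient.inductionOn
  rfl

/-- The normal cone `σ^a`, for an arbitrary `a ∈ S`. -/
def IsTotal.sigma (hI : IsTotal I) (a : singSub I) : NormalCone I.Obj where
  toSubCone := sigmaCone I a.1 a.2
  normal := by
    obtain ⟨q, hq⟩ := hI.exists_isTransversal (Pow.im a.1)
    refine ⟨q, (isIso_iff_bijective _).mpr ?_⟩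
    rw [show (sigmaCone I a.1 a.2).app q = hq.equiv ∘ blocksEquivIm a.1 from
      funext (sigmaCone_app a.1 a.2 q)]
    exact hq.equiv.bijective.comp (blocksEquivIm a.1).bijective

namespace IsTotal

variable (hI : IsTotal I)

theorem star_eq_sigma {γ : NormalCone I.Obj} {p : I.Obj} {η : γ.vertex ⟶ p} {a : singSub I}
    (hp : Sub (ker a.1) p.1)
    (h : ∀ (q : I.Obj) (x : X),
      γ.app q (η (Quotient.mk p.1.rel x)) = Quotient.mk q.1.rel (a.1.toFun x)) :
    γ.star η = hI.sigma a := by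
  refine NormalCone.star_eq_of_app_comp_incl (δ := hI.sigma a) hp fun q => funext fun c => ?_
  induction c using Quotient.inductionOn with
  | h x => exact h q x

theorem sigma_mul (a b : singSub I) : hI.sigma b * hI.sigma a = hI.sigma (a * b) :=
  hI.star_eq_sigma (p := ⟨ker a.1, a.2⟩) (fun _ _ e => congrArg b.1.toFun e) fun _ _ => rfl

theorem sigma_isIdempotentElem_iff {a : singSub I} :
    IsIdempotentElem (hI.sigma a) ↔ IsIdempotentElem a.1 := by
  rw [NormalCone.isIdempotentElem_iff]
  refine ⟨fun h => Sing.isIdempotentElem_iff.mpr fun x => ?_, sigmaCone_app_vertex I a.1 a.2⟩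
  exact Quotient.exact (congrFun h (Quotient.mk (ker a.1).rel x))

end IsTotal

theorem sigma_star (hI : IsTotal I) {e : Sing X} (h : ker e ∈ I.carrier) (he : IsIdempotentElem e)
    {q : I.Obj} (η : (sigma I e h he).vertex ⟶ q) :
    (sigma I e h he).star η = hI.sigma (toSingSub fun c => blocksEquivIm e (η c)) :=
  hI.star_eq_sigma (sub_ker_toSing _) fun r _ => sigmaCone_app e h r _

theorem blocksEquivIm_hat {e e' : Sing X} (h : ker e ∈ I.carrier) (he : IsIdempotentElem e)
    (h' : ker e' ∈ I.carrier) (he' : IsIdempotentElem e') (f : Pow.im e ⟶ Pow.im e')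
    (c : Quotient (ker e).rel) :
    blocksEquivIm e' (hat I h he h' he' f c) = f (blocksEquivIm e c) := by
  induction c using Quotient.inductionOn with
  | h x =>
    obtain ⟨y, hy⟩ := (f ⟨e.toFun x, x, rfl⟩).2
    refine Subtype.ext ?_
    change e'.toFun (f ⟨e.toFun x, x, rfl⟩).1 = (f ⟨e.toFun x, x, rfl⟩).1
    rw [← hy, Sing.isIdempotentElem_iff.mp he']

namespace IsTransversal

variable {p q : I.Obj} {A B : Pow X}

/-- The idempotent cone with vertex `p` given by a transversal `A` of `p`: it is `σ^e` for the
idempotent `e` with `π_e = p` and `Im e = A`, written so that its vertex is `p` on the nose. -/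
noncomputable def cone (h : IsTransversal p.1 A) : NormalCone I.Obj where
  vertex := p
  app r c := Quotient.mk r.1.rel (h.equiv.symm c).1
  compat _ := rfl
  normal := ⟨p, by
    rw [show (fun c => Quotient.mk p.1.rel (h.equiv.symm c).1) = 𝟙 p from funext h.mk_equiv_symm]
    infer_instance⟩

theorem cone_app (h : IsTransversal p.1 A) (r : I.Obj) (c : Quotient p.1.rel) :
    h.cone.app r c = Quotient.mk r.1.rel (h.equiv.symm c).1 := rfl

theorem isIdempotentElem_cone (h : IsTransversal p.1 A) : IsIdempotentElem h.cone :=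
  NormalCone.isIdempotentElem_iff.mpr (funext h.mk_equiv_symm)

theorem isIso_cone_app_iff (h : IsTransversal p.1 A) (r : I.Obj) :
    IsIso (h.cone.app r) ↔ IsTransversal r.1 A :=
  (isIso_iff_bijective _).trans (h.equiv.symm.bijective.of_comp_iff fun x : A.carrier =>
    Quotient.mk r.1.rel x.1)

/-- The maps from `A` to `B` are the morphisms in the opposite direction between partitions with
these transversals. -/
noncomputable def homEquiv (h : IsTransversal p.1 A) (h' : IsTransversal q.1 B) :
    (A ⟶ B) ≃ (h'.cone.vertex ⟶ h.cone.vertex) :=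
  Equiv.arrowCongr h.equiv h'.equiv

theorem cone_app_comp_homEquiv_incl (h : IsTransversal p.1 A) (h' : IsTransversal q.1 B)
    (k : Sub A B) (r : I.Obj) : h'.cone.app r ≫ h.homEquiv h' (incl k) = h.cone.app r :=
  funext fun c => congrArg (fun x : B.carrier => Quotient.mk r.1.rel x.1)
    (h'.equiv.symm_apply_apply (incl k (h.equiv.symm c)))

theorem ofCone_cone_eq (h : IsTransversal p.1 A) (h' : IsTransversal q.1 A) :
    NormalDual.ofCone h.cone h.isIdempotentElem_cone =
      NormalDual.ofCone h'.cone h'.isIdempotentElem_cone :=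
  NormalDual.ofCone_eq_of_app_comp (cone_app_comp_homEquiv_incl h h' (sub_refl A))
    (cone_app_comp_homEquiv_incl h' h (sub_refl A))

/-- The bijection from the maps `X/q → A` onto `H(σ^e; q)`, where `Im e = A`: it takes `j` to `σ^a`,
where `a` is the transformation `x ↦ j [x]`. -/
noncomputable def coneEquiv (h : IsTransversal p.1 A) (q : I.Obj) :
    (Quotient q.1.rel → A.carrier) ≃ (NormalDual.ofCone h.cone h.isIdempotentElem_cone).obj q :=
  Equiv.trans (β := h.cone.vertex ⟶ q) (Equiv.arrowCongr (Equiv.refl _) h.equiv)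
    (NormalDual.objEquiv h.isIdempotentElem_cone q)

theorem coneEquiv_val (hI : IsTotal I) (h : IsTransversal p.1 A)
    (j : Quotient q.1.rel → A.carrier) : (h.coneEquiv q j).1 = hI.sigma (toSingSub j) :=
  hI.star_eq_sigma (sub_ker_toSing j) fun r _ =>
    congrArg (fun y : A.carrier => Quotient.mk r.1.rel y.1) (h.equiv.symm_apply_apply (j _))

theorem ofCone_map_coneEquiv (h : IsTransversal p.1 A) {r : I.Obj} (η : q ⟶ r)
    (j : Quotient q.1.rel → A.carrier) :
    (NormalDual.ofCone h.cone h.isIdempotentElem_cone).map η (h.coneEquiv q j) =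
      h.coneEquiv r fun c => j (η c) :=
  NormalDual.map_objEquiv _ _

theorem homOf_homEquiv_app_coneEquiv (h : IsTransversal p.1 A) (h' : IsTransversal q.1 B)
    (f : A ⟶ B) {r : I.Obj} (j : Quotient r.1.rel → A.carrier) :
    NormalDual.Hom.app (NormalDual.homOf h.isIdempotentElem_cone h'.isIdempotentElem_cone
      (h.homEquiv h' f)) r (h.coneEquiv r j) = h'.coneEquiv r fun c => f (j c) := by
  refine (NormalDual.homOf_app_objEquiv _ _).trans
    (congrArg (NormalDual.objEquiv h'.isIdempotentElem_cone r) (funext fun c => ?_))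
  exact congrArg (fun x => h'.equiv (f x)) (h.equiv.symm_apply_apply (j c))

end IsTransversal

theorem sigma_eq_cone {e : Sing X} (h : ker e ∈ I.carrier) (he : IsIdempotentElem e) :
    sigma I e h he = IsTransversal.cone (p := ⟨ker e, h⟩) (isTransversal_ker_im he) := by
  have hv : (sigma I e h he).vertex = (⟨ker e, h⟩ : I.Obj) := rfl
  refine NormalCone.ext' hv fun q => (Category.comp_id (obj := I.Obj) _).trans (funext fun c => ?_)
  induction c using Quotient.inductionOn with
  | h x =>
    have mk_apply : Quotient.mk (ker e).rel (e.toFun x) = Quotient.mk (ker e).rel x :=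
      Quotient.sound (Sing.isIdempotentElem_iff.mp he x)
    have equiv_symm_mk := (isTransversal_ker_im he).equiv_symm_mk ⟨e.toFun x, x, rfl⟩
    rw [mk_apply] at equiv_symm_mk
    exact congrArg (fun y : (Pow.im e).carrier => Quotient.mk q.1.rel y.1) equiv_symm_mk.symm

/-! ### The dual cross-connection -/

theorem apply_mk_of_isIdempotentElem_toSing {p : Partn X} {A : Pow X}
    {j : Quotient p.rel → A.carrier} (hj : IsIdempotentElem (toSing j))
    (him : Pow.im (toSing j) = A) (a : A.carrier) : j (Quotient.mk p.rel a.1) = a := by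
  obtain ⟨x, hx⟩ : a.1 ∈ (Pow.im (toSing j)).carrier := by
    rw [him]
    exact a.2
  rw [← hx]
  exact Subtype.ext ((Sing.isIdempotentElem_iff.mp hj x).trans hx)

theorem mk_apply_of_isIdempotentElem_toSing {p : Partn X} {A : Pow X}
    {j : Quotient p.rel → A.carrier} (hj : IsIdempotentElem (toSing j))
    (hker : ker (toSing j) = p) (c : Quotient p.rel) : Quotient.mk p.rel (j c).1 = c := by
  induction c using Quotient.inductionOn with
  | h x =>
    have : (ker (toSing j)).rel (j (Quotient.mk p.rel x)).1 x := Sing.isIdempotentElem_iff.mp hj x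
    rw [hker] at this
    exact Quotient.sound this

namespace IsTotal

variable (hI : IsTotal I)

/-- A chosen partition in a total ideal with `A` as a transversal. -/
noncomputable def partn (A : Pow X) : I.Obj := (hI.exists_isTransversal A).choose

theorem isTransversal_partn (A : Pow X) : IsTransversal (hI.partn A).1 A :=
  (hI.exists_isTransversal A).choose_spec

/-- The dual cross-connection `A ↦ H(σ^e; -)`, where `e` is the idempotent with image `A` and the
chosen kernel. -/
noncomputable def dual : Pow X ⥤ NormalDual I.Obj where
  obj A := NormalDual.ofCone (hI.isTransversal_partn A).cone
    (hI.isTransversal_partn A).isIdempotentElem_cone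
  map f := NormalDual.homOf _ _
    ((hI.isTransversal_partn _).homEquiv (hI.isTransversal_partn _) f)
  map_id A := by
    rw [← NormalDual.homOf_id]
    exact congrArg _ (funext (hI.isTransversal_partn A).equiv.apply_symm_apply)
  map_comp {A B _} f g := by
    rw [← NormalDual.homOf_comp]
    exact congrArg _ (Equiv.arrowCongr_comp _ (hI.isTransversal_partn B).equiv _ f g)

theorem dual_obj_eq_ofCone {A : Pow X} {p : I.Obj} (h : IsTransversal p.1 A) :
    hI.dual.obj A = NormalDual.ofCone h.cone h.isIdempotentElem_cone :=
  (hI.isTransversal_partn A).ofCone_cone_eq h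

/-- The bijection from the maps `X/p → A` onto `Δ(A, p)`. -/
noncomputable def dualEquiv (A : Pow X) (p : I.Obj) :
    (Quotient p.1.rel → A.carrier) ≃ (hI.dual.obj A).obj p :=
  (hI.isTransversal_partn A).coneEquiv p

theorem dualEquiv_val {A : Pow X} {p : I.Obj} (j : Quotient p.1.rel → A.carrier) :
    (hI.dualEquiv A p j).1 = hI.sigma (toSingSub j) :=
  (hI.isTransversal_partn A).coneEquiv_val hI j

theorem dual_map_app_dualEquiv {A B : Pow X} (f : A ⟶ B) {p : I.Obj}
    (j : Quotient p.1.rel → A.carrier) :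
    NormalDual.Hom.app (hI.dual.map f) p (hI.dualEquiv A p j) =
      hI.dualEquiv B p fun c => f (j c) :=
  (hI.isTransversal_partn A).homOf_homEquiv_app_coneEquiv _ f j

theorem rightMap_dual {A B : Pow X} {p q : I.Obj} (f : A ⟶ B) (η : p ⟶ q)
    (j : Quotient p.1.rel → A.carrier) :
    rightMap hI.dual f η (hI.dualEquiv A p j) = hI.dualEquiv B q fun c => f (j (η c)) :=
  (congrArg (NormalDual.Hom.app (hI.dual.map f) q)
    ((hI.isTransversal_partn A).ofCone_map_coneEquiv η j)).trans (hI.dual_map_app_dualEquiv f _)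

theorem exists_eq_sigma_toSingSub {A : Pow X} {p : I.Obj} {δ : NormalCone I.Obj}
    (hδ : δ ∈ (hI.dual.obj A).obj p) :
    ∃ j : Quotient p.1.rel → A.carrier, δ = hI.sigma (toSingSub j) := by
  obtain ⟨j, hj⟩ := (hI.dualEquiv A p).surjective ⟨δ, hδ⟩
  exact ⟨j, by rw [← dualEquiv_val, hj]⟩

theorem mem_mSet_dual {A : Pow X} {p : I.Obj} :
    p ∈ (hI.dual.obj A).mSet ↔ IsTransversal p.1 A :=
  (NormalDual.mem_mSet_ofCone (h := (hI.isTransversal_partn A).isIdempotentElem_cone)).trans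
    ((hI.isTransversal_partn A).isIso_cone_app_iff p)

theorem dual_obj_im {e : Sing X} (h : ker e ∈ I.carrier) (he : IsIdempotentElem e) :
    hI.dual.obj (Pow.im e) = NormalDual.ofCone (Partn.sigma I e h he) (sigma_idem I e h he) :=
  (hI.dual_obj_eq_ofCone (p := ⟨ker e, h⟩) (isTransversal_ker_im he)).trans
    (NormalDual.ofCone_congr (sigma_eq_cone h he).symm)

theorem dual_isIdentity : IsIdentity I hI.dual := by
  refine ⟨fun e h he => hI.dual_obj_im h he, fun e e' h he h' he' f p η hη => ?_⟩
  have star_eq : (⟨(Partn.sigma I e h he).star η, hη⟩ : (hI.dual.obj (Pow.im e)).obj p) =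
      hI.dualEquiv (Pow.im e) p fun c => blocksEquivIm e (η c) :=
    Subtype.ext ((sigma_star hI h he η).trans (hI.dualEquiv_val _).symm)
  rw [star_eq, dual_map_app_dualEquiv, dualEquiv_val, sigma_star hI]
  exact congrArg (fun j => hI.sigma (toSingSub (p := p) j))
    (funext fun c => (blocksEquivIm_hat h he h' he' f (η c)).symm)

theorem dual_isLocalIso : IsLocalIso hI.dual := by
  refine IsLocalIso.of_bijective_map
    (fun k => NormalDual.exists_homOf_eq_incl _
      ((hI.isTransversal_partn _).cone_app_comp_homEquiv_incl (hI.isTransversal_partn _) k))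
    (fun A B => NormalDual.homOf_bijective.comp (Equiv.bijective _)) fun A F hF => ?_
  obtain ⟨ε, hε, p, rfl, hmem⟩ := NormalDual.exists_eq_ofCone_of_sub hF
  obtain ⟨j, rfl⟩ := hI.exists_eq_sigma_toSingSub hmem
  exact ⟨Pow.im (toSing j), im_toSing_sub j,
    hI.dual_obj_im (toSingSub j).2 (hI.sigma_isIdempotentElem_iff.mp hε)⟩

theorem dual_isCrossConnection : IsCrossConnection hI.dual :=
  ⟨hI.dual_isLocalIso, fun p => by
    obtain ⟨x⟩ := p.1.nonempty
    obtain ⟨A, -, hA⟩ := p.1.exists_isTransversal_mem x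
    exact ⟨A, hI.mem_mSet_dual.mpr hA⟩⟩

/-- The bijection from `Γ(A, p)` onto `Δ(A, p)` that takes `ρ^a` to `σ^a`. -/
noncomputable def gammaEquivDual (A : Pow X) (p : I.Obj) :
    ((gamma I).obj p).obj A ≃ (hI.dual.obj A).obj p :=
  (toDualEquiv p.1 A).symm.trans (hI.dualEquiv A p)

theorem gammaEquivDual_toDualEquiv {A : Pow X} {p : I.Obj} (j : Quotient p.1.rel → A.carrier) :
    hI.gammaEquivDual A p (toDualEquiv p.1 A j) = hI.dualEquiv A p j :=
  congrArg (hI.dualEquiv A p) ((toDualEquiv p.1 A).symm_apply_apply j)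

/-- The duality between `Γ` and `Δ` that takes `ρ^a` to `σ^a`. -/
noncomputable def duality : Duality (gamma I) hI.dual where
  isCross := gamma_isCrossConnection hI
  isCross_dual := hI.dual_isCrossConnection
  mem_iff _ _ := mem_mSet_toDual.trans hI.mem_mSet_dual.symm
  χ := hI.gammaEquivDual
  naturality {A B p q} f η x := by
    obtain ⟨j, rfl⟩ := (toDualEquiv p.1 A).surjective x
    rw [leftMap_gamma, gammaEquivDual_toDualEquiv, gammaEquivDual_toDualEquiv, rightMap_dual]
  unit A p x y hx hxA _ hy hyp _ := by
    obtain ⟨j, rfl⟩ := (toDualEquiv p.1 A).surjective x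
    obtain ⟨k, rfl⟩ := (hI.dualEquiv A p).surjective y
    rw [toDualEquiv_val] at hx hxA
    rw [dualEquiv_val] at hy hyp
    have j_mk : ∀ a : A.carrier, j (Quotient.mk _ a.1) = a :=
      apply_mk_of_isIdempotentElem_toSing (Pow.rho_isIdempotentElem_iff.mp hx) hxA
    have mk_k : ∀ c, Quotient.mk p.1.rel (k c).1 = c :=
      mk_apply_of_isIdempotentElem_toSing (hI.sigma_isIdempotentElem_iff.mp hy)
        (congrArg Subtype.val hyp)
    have : j = k := funext fun c => by rw [← j_mk (k c), mk_k]
    rw [gammaEquivDual_toDualEquiv, this]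

end IsTotal

/-! ### Uniqueness of the dual -/

section Uniqueness

variable {Δ : Pow X ⥤ NormalDual I.Obj} (D : Duality (gamma I) Δ) {A B : Pow X} {p : I.Obj}

/-- `y` is the idempotent cone `δ(A, p)` of the duality `D`, where `p` is the vertex of `y`; the
last condition says that it is the value of `χ(A, p)` at the cone `γ(A, p) = ρ^e`. -/
structure IsUnitCone (A : Pow X) (y : NormalCone I.Obj) : Prop where
  idem : IsIdempotentElem y
  transversal : IsTransversal y.vertex.1 A
  obj_eq : Δ.obj A = NormalDual.ofCone y idem
  χ_eq : (D.χ A y.vertex (toDualEquiv y.vertex.1 A transversal.equiv.symm)).1 = y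

theorem exists_isUnitCone (h : IsTransversal p.1 A) : ∃ y, y.vertex = p ∧ IsUnitCone D A y := by
  obtain ⟨y, hy, rfl, hobj⟩ :=
    NormalDual.exists_eq_ofCone_of_mem_mSet ((D.mem_iff A p).mp (mem_mSet_toDual.mpr h))
  have hmem : y ∈ (Δ.obj A).obj y.vertex := hobj ▸ NormalDual.self_mem_obj_vertex (h := hy)
  refine ⟨y, rfl, hy, h, hobj, congrArg Subtype.val (D.unit A y.vertex
    (toDualEquiv y.vertex.1 A h.equiv.symm) ⟨y, hmem⟩ ?_ ?_ ?_ hy rfl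
    (congrArg NormalDual.toConeFunctor hobj))⟩
  all_goals rw [toDualEquiv_val]
  · exact Pow.rho_isIdempotentElem_iff.mpr h.isIdempotentElem_toSing
  · exact h.im_toSing
  · exact congrArg NormalDual.toConeFunctor
      (toDual_obj_eq_ofCone h.isIdempotentElem_toSing h.ker_toSing)

theorem map_app_χ (f : A ⟶ B) (j : Quotient p.1.rel → A.carrier) :
    NormalDual.Hom.app (Δ.map f) p (D.χ A p (toDualEquiv p.1 A j)) =
      D.χ B p (toDualEquiv p.1 B fun c => f (j c)) := by
  have h := D.naturality f (𝟙 p) (toDualEquiv p.1 A j)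
  rw [leftMap_gamma, rightMap, (Δ.obj A).map_id] at h
  exact h.symm

theorem χ_comp_incl (h : Sub A B) (j : Quotient p.1.rel → A.carrier) :
    (D.χ B p (toDualEquiv p.1 B fun c => incl h (j c))).1 =
      (D.χ A p (toDualEquiv p.1 A j)).1 := by
  obtain ⟨k, hk⟩ := D.isCross_dual.localIso.map_incl h
  rw [← map_app_χ, hk]
  rfl

namespace IsUnitCone

variable {D} {y : NormalCone I.Obj}

theorem χ_val (hy : IsUnitCone D A y) (j : Quotient p.1.rel → A.carrier) :
    (D.χ A p (toDualEquiv p.1 A j)).1 =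
      y.star (d := p) fun c => Quotient.mk y.vertex.1.rel (j c).1 := by
  let η : y.vertex ⟶ p := fun c => Quotient.mk y.vertex.1.rel (j c).1
  have leftMap_eq : leftMap (gamma I) (𝟙 A) η
      (toDualEquiv y.vertex.1 A hy.transversal.equiv.symm) = toDualEquiv p.1 A j :=
    (leftMap_gamma _ _ _).trans
      (congrArg _ (funext fun c => hy.transversal.equiv_symm_mk (j c)))
  have naturality := D.naturality (𝟙 A) η (toDualEquiv y.vertex.1 A hy.transversal.equiv.symm)
  rw [leftMap_eq, rightMap, Δ.map_id] at naturality
  rw [naturality]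
  exact NormalDual.map_val_eq_star hy.obj_eq η _ hy.χ_eq

-- For `x ∈ A`, choose a transversal `B` of `q` through `x`. Since `Δ` preserves the inclusions of
-- `{x}` in `A` and `B`, the cone that `χ` assigns to the constant map `x` can be computed from
-- `δ(A, p)` as well as from `δ(B, q)`, and the component of the latter at `q` is the identity.
theorem app_mk (hy : IsUnitCone D A y) (x : A.carrier) (q : I.Obj) :
    y.app q (Quotient.mk y.vertex.1.rel x.1) = Quotient.mk q.1.rel x.1 := by
  obtain ⟨B, hxB, hB⟩ := q.1.exists_isTransversal_mem x.1
  obtain ⟨z, rfl, hz⟩ := exists_isUnitCone D hB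
  have := z.vertex.1.idem.nontrivial
  have singleton_sub_left : Sub (Pow.singleton x.1) A := Set.singleton_subset_iff.mpr x.2
  have singleton_sub_right : Sub (Pow.singleton x.1) B := Set.singleton_subset_iff.mpr hxB
  let const : Quotient z.vertex.1.rel → (Pow.singleton x.1).carrier := fun _ => ⟨x.1, rfl⟩
  have star_eq := (χ_comp_incl D singleton_sub_left const).trans
    (χ_comp_incl D singleton_sub_right const).symm
  rw [hy.χ_val, hz.χ_val, NormalCone.star_eq_star_iff] at star_eq
  calc y.app z.vertex (Quotient.mk _ x.1) = z.app z.vertex (Quotient.mk _ x.1) :=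
        congrFun (star_eq z.vertex) (Quotient.mk _ x.1)
    _ = Quotient.mk _ x.1 :=
        congrFun (NormalCone.isIdempotentElem_iff.mp hz.idem) (Quotient.mk _ x.1)

theorem eq_cone (hy : IsUnitCone D A y) : y = hy.transversal.cone := by
  have hv : y.vertex = hy.transversal.cone.vertex := rfl
  refine NormalCone.ext' hv fun q => (Category.comp_id (obj := I.Obj) _).trans (funext fun c => ?_)
  obtain ⟨x, rfl⟩ := hy.transversal.equiv.surjective c
  rw [IsTransversal.cone_app, Equiv.symm_apply_apply]
  exact hy.app_mk x q

end IsUnitCone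

theorem isUnitCone_cone (h : IsTransversal p.1 A) : IsUnitCone D A h.cone := by
  obtain ⟨y, rfl, hy⟩ := exists_isUnitCone D h
  exact hy.eq_cone ▸ hy

theorem χ_toDualEquiv_val (hI : IsTotal I) (j : Quotient p.1.rel → A.carrier) :
    (D.χ A p (toDualEquiv p.1 A j)).1 = hI.sigma (toSingSub j) :=
  ((isUnitCone_cone D (hI.isTransversal_partn A)).χ_val j).trans (hI.dualEquiv_val j)

end Uniqueness

theorem eq_dual {Δ : Pow X ⥤ NormalDual I.Obj} (D : Duality (gamma I) Δ) (hI : IsTotal I) :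
    Δ = hI.dual := by
  refine NormalDual.functor_ext
    (fun A => (isUnitCone_cone D (hI.isTransversal_partn A)).obj_eq) fun {A B} f p x y hxy => ?_
  obtain ⟨j, rfl⟩ := (hI.dualEquiv A p).surjective y
  have hx : x = D.χ A p (toDualEquiv p.1 A j) := Subtype.ext (by
    rw [hxy, hI.dualEquiv_val, χ_toDualEquiv_val D hI])
  rw [hx, map_app_χ, χ_toDualEquiv_val D hI, hI.dual_map_app_dualEquiv, hI.dualEquiv_val]

/-! ### The semigroup of linked pairs -/

section LinkedPairs

variable (hI : IsTotal I)

/-- The homomorphism `a ↦ (ρ^a, σ^a)`. -/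
def IsTotal.toPair : singSub I →ₙ* NormalCone (Pow X) × (NormalCone I.Obj)ᵐᵒᵖ where
  toFun a := (Pow.rho a.1, MulOpposite.op (hI.sigma a))
  map_mul' a b := Prod.ext (Pow.rho_mul a.1 b.1).symm
    (congrArg MulOpposite.op (hI.sigma_mul a b).symm)

theorem IsTotal.toPair_injective : Function.Injective hI.toPair :=
  fun _ _ h => Subtype.ext (Pow.rho_injective (congrArg Prod.fst h))

variable {Δ : Pow X ⥤ NormalDual I.Obj} (D : Duality (gamma I) Δ)

theorem mem_linkedPairs_iff {x : NormalCone (Pow X) × (NormalCone I.Obj)ᵐᵒᵖ} :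
    x ∈ linkedPairs D ↔
      ∃ (A : Pow X) (p : I.Obj) (j : Quotient p.1.rel → A.carrier),
        hI.toPair (toSingSub j) = x := by
  obtain ⟨γ, δ⟩ := x
  refine exists₂_congr fun A p => ?_
  have χ_val : ∀ (j : Quotient p.1.rel → A.carrier)
      (h : Pow.rho (toSing j) ∈ ((toDual X).obj p.1).obj A),
      (D.χ A p ⟨Pow.rho (toSing j), h⟩).1 = hI.sigma (toSingSub j) := fun j h => by
    rw [← χ_toDualEquiv_val D hI]
    exact congrArg (fun y => (D.χ A p y).1) (Subtype.ext (toDualEquiv_val j).symm)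
  constructor
  · rintro ⟨h, hδ⟩
    obtain ⟨j, rfl⟩ := exists_eq_rho_toSing h
    exact ⟨j, congrArg (Prod.mk _) (MulOpposite.unop_injective (hδ.trans (χ_val j h)).symm)⟩
  · rintro ⟨j, h⟩
    obtain ⟨rfl, rfl⟩ := Prod.mk.inj h
    have mem : Pow.rho (toSing j) ∈ ((toDual X).obj p.1).obj A :=
      toDualEquiv_val j ▸ (toDualEquiv p.1 A j).2
    exact ⟨mem, (χ_val j mem).symm⟩

theorem range_toPair : Set.range hI.toPair = linkedPairs D := by
  ext x
  rw [mem_linkedPairs_iff hI]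
  constructor
  · rintro ⟨a, rfl⟩
    exact ⟨Pow.im a.1, ⟨ker a.1, a.2⟩, blocksEquivIm a.1,
      congrArg hI.toPair (Subtype.ext (toSing_blocksEquivIm a.1))⟩
  · rintro ⟨A, p, j, h⟩
    exact ⟨toSingSub j, h⟩

end LinkedPairs

theorem exists_mulEquiv_linkedPairs (hI : IsTotal I) {Δ : Pow X ⥤ NormalDual I.Obj}
    (D : Duality (gamma I) Δ) :
    ∃ S : Subsemigroup (NormalCone (Pow X) × (NormalCone I.Obj)ᵐᵒᵖ),
      (S : Set (NormalCone (Pow X) × (NormalCone I.Obj)ᵐᵒᵖ)) = linkedPairs D ∧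
      ∃ φ : singSub I ≃* S, ∀ a : singSub I, (φ a).1.1 = Pow.rho a.1 ∧
        (φ a).1.2.unop.toSubCone = sigmaCone I a.1 a.2 :=
  ⟨hI.toPair.srange, (MulHom.coe_srange _).trans (range_toPair hI D),
    MulEquiv.ofBijective hI.toPair.srangeRestrict
      ⟨fun _ _ h => hI.toPair_injective (congrArg Subtype.val h),
        hI.toPair.srangeRestrict_surjective⟩,
    fun _ => ⟨rfl, rfl⟩⟩

theorem singSub_isRegularSemigroup (hI : IsTotal I) : IsRegularSemigroup (singSub I) := by
  intro a
  obtain ⟨p, hp⟩ := hI.exists_isTransversal (Pow.im a.1)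
  obtain ⟨x⟩ := p.1.nonempty
  obtain ⟨A, -, hA⟩ := (ker a.1).exists_isTransversal_mem x
  let preimage : (Pow.im a.1).carrier → A.carrier := fun y =>
    hA.equiv.symm ((blocksEquivIm a.1).symm y)
  have apply_preimage : ∀ y, a.1.toFun (preimage y) = y := fun y => by
    have := blocksEquivIm_mk a.1 (preimage y)
    rw [hA.mk_equiv_symm, Equiv.apply_symm_apply] at this
    exact congrArg Subtype.val this.symm
  refine ⟨toSingSub fun c => preimage (hp.equiv.symm c),
    Subtype.ext (Sing.ext (funext fun x => (apply_preimage _).trans ?_))⟩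
  exact congrArg Subtype.val (hp.equiv_symm_mk ⟨a.1.toFun x, x, rfl⟩)

theorem singSub_isRightReductive : IsRightReductive (singSub I) := by
  intro a b h
  have := a.1.nontrivial
  refine Subtype.ext (Sing.ext (funext fun x => ?_))
  let const : singSub I :=
    toSingSub (p := ⟨ker a.1, a.2⟩) (A := Pow.singleton x) fun _ => ⟨x, rfl⟩
  have const_mul_eq : const * a = const * b := congrFun h const
  exact congrFun (congrArg (fun c : singSub I => c.1.toFun) const_mul_eq) x

end Partn

end CrossConnection

theorem mainTheorem8 (X : Type u) [Nontrivial X]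
    (I : CrossConnection.CatIdeal (CrossConnection.Partn X))
    (hI : CrossConnection.Partn.IsTotal I) :
    CrossConnection.IsCrossConnection (CrossConnection.Partn.gamma I) ∧
    ∃ Δ : CrossConnection.Pow X ⥤ CrossConnection.NormalDual I.Obj,
      CrossConnection.Partn.IsIdentity I Δ ∧
      Nonempty (CrossConnection.Duality (CrossConnection.Partn.gamma I) Δ) ∧
      (∀ Δ' : CrossConnection.Pow X ⥤ CrossConnection.NormalDual I.Obj,
        Nonempty (CrossConnection.Duality (CrossConnection.Partn.gamma I) Δ') → Δ' = Δ) ∧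
      (∀ χ : CrossConnection.Duality (CrossConnection.Partn.gamma I) Δ,
        ∃ S : Subsemigroup (CrossConnection.NormalCone (CrossConnection.Pow X) ×
            (CrossConnection.NormalCone I.Obj)ᵐᵒᵖ),
          (S : Set (CrossConnection.NormalCone (CrossConnection.Pow X) ×
            (CrossConnection.NormalCone I.Obj)ᵐᵒᵖ)) = CrossConnection.linkedPairs χ ∧
          ∃ φ : CrossConnection.Partn.singSub I ≃* S, ∀ a : CrossConnection.Partn.singSub I,
            (φ a).1.1 = CrossConnection.Pow.rho a.1 ∧
            (φ a).1.2.unop.toSubCone = CrossConnection.Partn.sigmaCone I a.1 a.2) ∧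
      CrossConnection.IsRegularSemigroup (CrossConnection.Partn.singSub I) ∧
      CrossConnection.IsRightReductive (CrossConnection.Partn.singSub I) :=
  ⟨CrossConnection.Partn.gamma_isCrossConnection hI, CrossConnection.Partn.IsTotal.dual hI,
    CrossConnection.Partn.IsTotal.dual_isIdentity hI, ⟨CrossConnection.Partn.IsTotal.duality hI⟩,
    fun _ ⟨D⟩ => CrossConnection.Partn.eq_dual D hI,
    CrossConnection.Partn.exists_mulEquiv_linkedPairs hI,
    CrossConnection.Partn.singSub_isRegularSemigroup hI,
    CrossConnection.Partn.singSub_isRightReductive⟩
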